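/- Let $d,m$ be natural numbers and $0<r<1$. Consider an iterated function system (IFS) $\{S_i\}_{i=1}^m$ on $\mathbb R^d$ of the form $S_i(x)=rR_ix+d_i$ with $R_i$ orthogonal and $d_i\in\mathbb R^d$, and let $K$ be the self-similar set it generates, i.e. the nonempty compact set with $K=\bigcup_{i=1}^m S_i(K)$. Let $\Sigma=\{1,\dots,m\}$ and $X=\bigcup_{n\ge 0}\Sigma^n$; for a word $\mathbf u=i_1\cdots i_n$ put $S_{\mathbf u}=S_{i_1}\circ\cdots\circ S_{i_n}$ and $E_{\mathbf u}=S_{\mathbf u}(E)$ for $E\subseteq\mathbb R^d$. $K$ is called dust-like (with respect to its IFS) if $S_i(K)\cap S_j(K)=\emptyset$ for $i\ne j$. Two sets are Lipschitz equivalent if there is a bi-Lipschitz bijection between them. Condition (H): there is $c>0$ such that for all $n\ge1$ and $\mathbf u,\mathbf v\in\Sigma^n$, $K_{\mathbf u}\cap K_{\mathbf v}=\emptyset$ implies $\operatorname{dist}(K_{\mathbf u},K_{\mathbf v})\ge c\,r^n$. Augmented tree: fix a nonempty bounded closed set $J$ with $S_i(J)\subseteq J$ for all $i$. The vertical edges of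 $X$ join $\mathbf u$ to $\mathbf ui$ ($i\in\Sigma$); the horizontal edges join distinct words $\mathbf u,\mathbf v$ of the same length with $J_{\mathbf u}\cap J_{\mathbf v}\neq\emptyset$. A component is a connected component $T$ of the horizontal graph (it lies in a single level $\Sigma^n$); $T\Sigma=\{\mathbf ui:\mathbf u\in T,\ i\in\Sigma\}$. Components $T,T'$ are equivalent if there is a bijection $T\cup T\Sigma\to T'\cup T'\Sigma$ which, together with its inverse, preserves vertical and horizontal edges. The augmented tree is simple if there are finitely many equivalence classes $\mathscr T_1,\dots,\mathscr T_q$ of components. In this case, for a choice of components $T_i\in\mathscr T_i$, the incidence matrix is $A=[a_{ij}]_{q\times q}$, where $a_{ij}$ is the number of components $Z\subseteq T_i\Sigma$ with $Z\in\mathscr T_j$, and $\mathbf b=[b_1,\dots,b_q]^t$ with $b_i=\#T_i$ (all components in a class have the same size). $A$ is $(m,\mathbf b)$-rearrangeable if for each row $\mathbf a$ of $A$ there are an integer $p>0$ and a nonnegative integral $p\times q$ matrix $C$ with $\mathbf a=[1,\dots,1]\,C$ and $C\mathbf b=[m,\dots,m]^t$. $A$ is primitive if some power $A^k$, $k\geq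 1$, has only positive entries. Theorem. Let $K$ and $K'$ be self-similar sets in $\mathbb R^d$ generated by two IFSs as above with the same number $m$ of maps and the same ratio $r$, both satisfying condition (H). Suppose that their augmented trees, with respect to invariant sets $J$ and $J'$ respectively, are simple, and that, for each of the two trees, either the incidence matrix is $(m,\mathbf b)$-rearrangeable for every choice of the components $T_i$, or it is primitive for every choice of the components $T_i$. Then $K$ and $K'$ are Lipschitz equivalent, and there is a dust-like self-similar set in $\mathbb R^d$ (generated by an IFS of the above form, with its own number of maps and its own ratio in $(0,1)$) to which both are Lipschitz equivalent. -/

import Mathlib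

open scoped NNReal Matrix

noncomputable section

/-- Two subsets of metric spaces are Lipschitz equivalent if there is a bi-Lipschitz bijection
between them (both the bijection and its inverse are Lipschitz). -/
def LipschitzEquivalent {α β : Type*} [MetricSpace α] [MetricSpace β]
    (A : Set α) (B : Set β) : Prop :=
  ∃ (f : A ≃ B) (C : ℝ≥0), LipschitzWith C f ∧ LipschitzWith C f.symm

/-- An IFS `S₁, …, S_m` of similitudes of `ℝᵈ` with common ratio `r`: `S_i x = r R_i x + d_i`,
where `R_i` is a linear isometry (an orthogonal matrix) and `d_i` a vector. -/
structure EqualRatioIFS (d m : ℕ) (r : ℝ) where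
  /-- the orthogonal parts `R_i` -/
  rot : Fin m → (EuclideanSpace ℝ (Fin d) ≃ₗᵢ[ℝ] EuclideanSpace ℝ (Fin d))
  /-- the translation parts `d_i` -/
  shift : Fin m → EuclideanSpace ℝ (Fin d)

namespace EqualRatioIFS

variable {d m : ℕ} {r : ℝ}

/-- The similitude `S_i`. -/
def map (F : EqualRatioIFS d m r) (i : Fin m) (x : EuclideanSpace ℝ (Fin d)) :
    EuclideanSpace ℝ (Fin d) :=
  r • F.rot i x + F.shift i

/-- `S_u = S_{i₁} ∘ ⋯ ∘ S_{i_n}` for the word `u = i₁ ⋯ i_n`; words over the alphabet `Fin m` are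
lists, the empty word being the root of the symbolic space. -/
def wordMap (F : EqualRatioIFS d m r) :
    List (Fin m) → EuclideanSpace ℝ (Fin d) → EuclideanSpace ℝ (Fin d)
  | [] => id
  | i :: u => F.map i ∘ F.wordMap u

/-- The cell `A_u = S_u(A)`. -/
def cell (F : EqualRatioIFS d m r) (A : Set (EuclideanSpace ℝ (Fin d))) (u : List (Fin m)) :
    Set (EuclideanSpace ℝ (Fin d)) :=
  F.wordMap u '' A

/-- `K` is the self-similar set generated by the IFS: the nonempty compact set with
`K = ⋃ᵢ S_i(K)`. -/
structure IsSelfSimilarSet (F : EqualRatioIFS d m r) (K : Set (EuclideanSpace ℝ (Fin d))) :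
    Prop where
  nonempty : K.Nonempty
  isCompact : IsCompact K
  eq_iUnion : K = ⋃ i, F.map i '' K

/-- `K` is the self-similar set of the IFS and the IFS is strongly separated. -/
structure IsDustLike (F : EqualRatioIFS d m r) (K : Set (EuclideanSpace ℝ (Fin d))) : Prop where
  isSelfSimilarSet : F.IsSelfSimilarSet K
  disjoint : ∀ i j, i ≠ j → Disjoint (F.map i '' K) (F.map j '' K)

/-- Condition (H): there is `c > 0` such that, for all `n ≥ 1` and words `u, v` of length `n`,
`K_u ∩ K_v = ∅` implies `dist (K_u, K_v) ≥ c rⁿ`. -/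
def ConditionH (F : EqualRatioIFS d m r) (K : Set (EuclideanSpace ℝ (Fin d))) : Prop :=
  ∃ c : ℝ, 0 < c ∧ ∀ n : ℕ, 1 ≤ n → ∀ u v : List (Fin m), u.length = n → v.length = n →
    Disjoint (F.cell K u) (F.cell K v) →
      ∀ x ∈ F.cell K u, ∀ y ∈ F.cell K v, c * r ^ n ≤ dist x y

/-- A (nonempty) bounded closed invariant set of the IFS: `S_i(J) ⊆ J` for every `i`. -/
structure IsInvariantSet (F : EqualRatioIFS d m r) (J : Set (EuclideanSpace ℝ (Fin d))) :
    Prop where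
  nonempty : J.Nonempty
  isClosed : IsClosed J
  isBounded : Bornology.IsBounded J
  image_subset : ∀ i, F.map i '' J ⊆ J

/-- The vertical edges: the tree of words, `u` being joined to its offsprings `u i`. -/
def vertical (m : ℕ) : SimpleGraph (List (Fin m)) where
  Adj u v := (∃ i, v = u ++ [i]) ∨ (∃ i, u = v ++ [i])
  symm := ⟨fun _ _ h => h.symm⟩
  loopless := ⟨fun u h => by
    rcases h with ⟨i, h⟩ | ⟨i, h⟩ <;> simpa using congrArg List.length h⟩

/-- The horizontal edges: distinct words `u, v` of the same length with `J_u ∩ J_v ≠ ∅`.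
The augmented tree is the set of words with the vertical and the horizontal edges. -/
def horizontal (F : EqualRatioIFS d m r) (J : Set (EuclideanSpace ℝ (Fin d))) :
    SimpleGraph (List (Fin m)) where
  Adj u v := u ≠ v ∧ u.length = v.length ∧ (F.cell J u ∩ F.cell J v).Nonempty
  symm := ⟨fun _ _ h => ⟨h.1.symm, h.2.1.symm, by rw [Set.inter_comm]; exact h.2.2⟩⟩
  loopless := ⟨fun _ h => h.1 rfl⟩

/-- Horizontal connected components. All vertices of a component are on the same level, because
horizontal edges join words of equal length. -/
abbrev Component (F : EqualRatioIFS d m r) (J : Set (EuclideanSpace ℝ (Fin d))) : Type :=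
  (F.horizontal J).ConnectedComponent

/-- The set `TΣ = {u i : u ∈ T, i ∈ Σ}` of offsprings of `T`. -/
def offspring {F : EqualRatioIFS d m r} {J : Set (EuclideanSpace ℝ (Fin d))}
    (T : F.Component J) : Set (List (Fin m)) :=
  {w | ∃ u ∈ T.supp, ∃ i, w = u ++ [i]}

/-- The vertex set `T ∪ TΣ`. -/
def family {F : EqualRatioIFS d m r} {J : Set (EuclideanSpace ℝ (Fin d))}
    (T : F.Component J) : Set (List (Fin m)) :=
  T.supp ∪ offspring T

/-- `T ∼ T'`: there is a bijection `T ∪ TΣ → T' ∪ T'Σ` that preserves, together with its inverse,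
the vertical and the horizontal edges. -/
def Equivalent {F : EqualRatioIFS d m r} {J : Set (EuclideanSpace ℝ (Fin d))}
    (T T' : F.Component J) : Prop :=
  ∃ g : family T ≃ family T',
    (∀ x y, (vertical m).Adj (g x : List (Fin m)) (g y) ↔ (vertical m).Adj (x : List (Fin m)) y) ∧
    (∀ x y, (F.horizontal J).Adj (g x : List (Fin m)) (g y) ↔
      (F.horizontal J).Adj (x : List (Fin m)) y)

/-- The equivalence relation `∼`; its classes are the connected classes. -/
def componentSetoid (F : EqualRatioIFS d m r) (J : Set (EuclideanSpace ℝ (Fin d))) :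
    Setoid (F.Component J) where
  r := Equivalent
  iseqv :=
    { refl := fun _ => ⟨Equiv.refl _, fun _ _ => Iff.rfl, fun _ _ => Iff.rfl⟩
      symm := fun ⟨g, hv, hh⟩ => ⟨g.symm,
        fun x y => by simpa using (hv (g.symm x) (g.symm y)).symm,
        fun x y => by simpa using (hh (g.symm x) (g.symm y)).symm⟩
      trans := fun ⟨g, hv, hh⟩ ⟨g', hv', hh'⟩ => ⟨g.trans g',
        fun x y => (hv' (g x) (g y)).trans (hv x y),
        fun x y => (hh' (g x) (g y)).trans (hh x y)⟩ }

/-- The connected class `[T]` of a component. -/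
def connectedClass {F : EqualRatioIFS d m r} {J : Set (EuclideanSpace ℝ (Fin d))}
    (T : F.Component J) : Quotient (F.componentSetoid J) :=
  Quotient.mk _ T

/-- The augmented tree is simple: there are finitely many connected classes. -/
def IsSimple (F : EqualRatioIFS d m r) (J : Set (EuclideanSpace ℝ (Fin d))) : Prop :=
  Finite (Quotient (F.componentSetoid J))

/-- `A` is an incidence matrix of the augmented tree and `b` the corresponding vector of sizes:
for some labelling `𝒯₀, …, 𝒯_{q-1}` of all connected classes and some choice of components `T i`
with `[T i] = 𝒯_i`, the entry `A i j` is the number of horizontal connected components `Z`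
consisting of offsprings of `T i` with `[Z] = 𝒯_j`, and `b i = #(T i)`. -/
def IsIncidence (F : EqualRatioIFS d m r) (J : Set (EuclideanSpace ℝ (Fin d))) {q : ℕ}
    (A : Matrix (Fin q) (Fin q) ℕ) (b : Fin q → ℕ) : Prop :=
  ∃ T : Fin q → F.Component J,
    Function.Bijective (fun i => connectedClass (T i)) ∧
    (∀ i j, A i j = {Z : F.Component J | Z.supp ⊆ offspring (T i) ∧
      connectedClass Z = connectedClass (T j)}.ncard) ∧
    (∀ i, b i = (T i).supp.ncard)

end EqualRatioIFS

/-- The row vector `a` is `(m, b)`-rearrangeable: for some `p > 0` there is a nonnegative integral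
`p × q` matrix `C` with `a = [1, …, 1] C` and `C b = [m, …, m]ᵗ`. -/
def RowRearrangeable {q : ℕ} (m : ℕ) (b a : Fin q → ℕ) : Prop :=
  ∃ p : ℕ, 0 < p ∧ ∃ C : Matrix (Fin p) (Fin q) ℕ,
    a = (fun _ => 1) ᵥ* C ∧ C *ᵥ b = fun _ => m

/-- A matrix is `(m, b)`-rearrangeable if each of its rows is. -/
def MatrixRearrangeable {q : ℕ} (m : ℕ) (b : Fin q → ℕ) (A : Matrix (Fin q) (Fin q) ℕ) : Prop :=
  ∀ i, RowRearrangeable m b (A i)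

namespace EqualRatioIFS

variable {d m : ℕ} {r : ℝ}

/-- The incidence matrix of the augmented tree is `(m, b)`-rearrangeable, `m` being the number of
maps and `b` the vector of sizes, whatever labelling and components are chosen to write it down. -/
def HasRearrangeableIncidence (F : EqualRatioIFS d m r)
    (J : Set (EuclideanSpace ℝ (Fin d))) : Prop :=
  ∀ (q : ℕ) (A : Matrix (Fin q) (Fin q) ℕ) (b : Fin q → ℕ),
    F.IsIncidence J A b → MatrixRearrangeable m b A

/-- The incidence matrix of the augmented tree is primitive (some positive power has only positive
entries), whatever labelling and components are chosen to write it down. -/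
def HasPrimitiveIncidence (F : EqualRatioIFS d m r)
    (J : Set (EuclideanSpace ℝ (Fin d))) : Prop :=
  ∀ (q : ℕ) (A : Matrix (Fin q) (Fin q) ℕ) (b : Fin q → ℕ),
    F.IsIncidence J A b → (A.map (Nat.cast : ℕ → ℤ)).IsPrimitive

end EqualRatioIFS

end

/-! The proof shows that both sets are bi-Lipschitz to the same model: the space of sequences over
`Fin m`, with `r ^ n` as the distance of sequences whose longest common prefix has length `n`
(`IsCoded`). Composing two codings gives the first claim.

To code `K`, let `piece K T` be the union of the cells `K_u`, `u ∈ T`. If component sizes are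
bounded, the piece has diameter of order at most `r ^ level T`, since a chain of cells joins any two
of its points. Distinct pieces of level `n ≥ 1` are at distance at least `c r ^ n` by condition (H).
So the components form a tree of well separated pieces, and it remains to match it with a tree of
cylinders. The natural addresses need not serve, because cells within a component may overlap.
Instead, a component is assigned an equinumerous set of words of the same length that agree except
in boundedly many last letters. This assignment passes to descendants of depth `k` when the
components among them can be split into `#T` groups of total size `m ^ k` (`HasGrouping`): each
group takes over the extensions of one assigned word. With `k` bounded, `isCoded_of_hasGrouping`
turns this into a coding.

Rearrangeability is exactly a grouping at depth one. For primitive matrices, singleton components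
occur below every component at bounded depth, hence in large numbers somewhat deeper; the large
components are then packed greedily and the singletons fill the gaps
(`exists_assignment_of_many_ones`).

For the dust-like set, a volume count of holes around `K` gives `m r ^ d < 1`
(`card_mul_pow_lt_one`). Hence for some `k` there is room for `m ^ k` disjoint cubes of side `r ^ k`
on a grid in the unit cube; the resulting dust-like set has the `k`-block recoding of the same model
(`exists_isDustLike_of_grid`, `IsCoded.block`). The case `m = 1` is trivial and treated apart. -/

/-! ### Codings by sequences and bi-Lipschitz maps -/

/-- `A` is coded by the sequences over `ι` with ratio `r`: a bijection from `A` onto `ℕ → ι` is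
bi-Lipschitz when the distance of two sequences with longest common prefix of length `n` is
`r ^ n`. -/
def IsCoded {α : Type*} [MetricSpace α] (A : Set α) (ι : Type*) (r : ℝ) : Prop :=
  ∃ (f : A ≃ (ℕ → ι)) (c C : ℝ), 0 < c ∧ 0 < C ∧ ∀ (n : ℕ) (x y : A),
    ((∀ i < n, f x i = f y i) → dist x y ≤ C * r ^ n) ∧
    ((∃ i < n, f x i ≠ f y i) → c * r ^ n ≤ dist x y)

theorem LipschitzEquivalent.refl {α : Type*} [MetricSpace α] (A : Set α) :
    LipschitzEquivalent A A :=
  ⟨Equiv.refl _, 1, LipschitzWith.id, LipschitzWith.id⟩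

theorem exists_first_ne {ι : Type*} {a b : ℕ → ι} (h : a ≠ b) :
    ∃ n, (∀ i < n, a i = b i) ∧ a n ≠ b n := by
  classical
  have h' : ∃ n, a n ≠ b n := Function.ne_iff.1 h
  exact ⟨Nat.find h', fun i hi => by simpa using Nat.find_min h' hi, Nat.find_spec h'⟩

namespace IsCoded

variable {α β : Type*} [MetricSpace α] [MetricSpace β] {A : Set α} {B : Set β} {r : ℝ}

/-- The coordinate change between two codings over the same alphabet is Lipschitz. -/
theorem exists_lipschitzWith {ι : Type*} (hr : 0 < r) {f : A ≃ (ℕ → ι)} {g : B ≃ (ℕ → ι)}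
    {c C : ℝ} (hc : 0 < c) (hC : 0 < C)
    (hf : ∀ (n : ℕ) (x y : A), (∃ i < n, f x i ≠ f y i) → c * r ^ n ≤ dist x y)
    (hg : ∀ (n : ℕ) (x y : B), (∀ i < n, g x i = g y i) → dist x y ≤ C * r ^ n) :
    ∃ M : ℝ≥0, LipschitzWith M (f.trans g.symm) := by
  refine ⟨⟨C / (c * r), by positivity⟩, LipschitzWith.of_dist_le_mul fun x y => ?_⟩
  rcases eq_or_ne x y with rfl | hxy
  · simp
  obtain ⟨n, hn, hne⟩ := exists_first_ne (fun h => hxy (f.injective h))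
  -- The first disagreement is at index `n`, so separation is available only at scale `r ^ (n + 1)`;
  -- this is the factor `r` in the constant `C / (c * r)`.
  have h1 := hf (n + 1) x y ⟨n, n.lt_succ_self, hne⟩
  have h2 := hg n ((f.trans g.symm) x) ((f.trans g.symm) y) (by simpa using hn)
  refine h2.trans ?_
  show C * r ^ n ≤ C / (c * r) * dist x y
  calc C * r ^ n = C / (c * r) * (c * r ^ (n + 1)) := by field_simp; ring
    _ ≤ _ := by gcongr

theorem lipschitzEquivalent {ι : Type*} (hr : 0 < r) (hA : IsCoded A ι r) (hB : IsCoded B ι r) :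
    LipschitzEquivalent A B := by
  obtain ⟨f, c, C, hc, hC, hf⟩ := hA
  obtain ⟨g, c', C', hc', hC', hg⟩ := hB
  obtain ⟨M, hM⟩ := exists_lipschitzWith hr (f := f) (g := g) hc hC' (fun n x y => (hf n x y).2)
    (fun n x y => (hg n x y).1)
  obtain ⟨N, hN⟩ := exists_lipschitzWith hr (f := g) (g := f) hc' hC (fun n x y => (hg n x y).2)
    (fun n x y => (hf n x y).1)
  exact ⟨f.trans g.symm, max M N, hM.weaken (le_max_left _ _), hN.weaken (le_max_right _ _)⟩

theorem relabel {ι κ : Type*} (e : ι ≃ κ) (hA : IsCoded A ι r) : IsCoded A κ r := by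
  obtain ⟨f, c, C, hc, hC, hf⟩ := hA
  refine ⟨f.trans (Equiv.arrowCongr (Equiv.refl ℕ) e), c, C, hc, hC, fun n x y => ?_⟩
  simpa [Equiv.arrowCongr] using hf n x y

/-- Recoding by blocks of length `k`. -/
theorem block {ι : Type*} (k : ℕ) [NeZero k] (hA : IsCoded A ι r) :
    IsCoded A (Fin k → ι) (r ^ k) := by
  obtain ⟨f, c, C, hc, hC, hf⟩ := hA
  let e : (ℕ → ι) ≃ (ℕ → Fin k → ι) :=
    (Equiv.arrowCongr (Nat.divModEquiv k) (Equiv.refl ι)).trans (Equiv.curry ℕ (Fin k) ι)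
  have he : ∀ a j (i : Fin k), e a j i = a (j * k + i) := by
    intro a j i
    simp [e, Equiv.arrowCongr, Nat.divModEquiv, Function.curry]
  have hk : 0 < k := Nat.pos_of_neZero k
  refine ⟨f.trans e, c, C, hc, hC, fun n x y => ⟨fun h => ?_, fun h => ?_⟩⟩
  · rw [← pow_mul]
    refine (hf (k * n) x y).1 fun i hi => ?_
    have := congrFun (h (i / k) (Nat.div_lt_of_lt_mul hi)) ⟨i % k, Nat.mod_lt _ hk⟩
    simpa [he, Nat.div_add_mod'] using this
  · rw [← pow_mul]
    obtain ⟨j, hj, hne⟩ := h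
    obtain ⟨i, hi⟩ := Function.ne_iff.1 hne
    refine (hf (k * n) x y).2 ⟨j * k + i, ?_, by simpa [he] using hi⟩
    calc j * k + i < j * k + k := by simp
      _ = k * (j + 1) := by ring
      _ ≤ k * n := Nat.mul_le_mul_left k hj

end IsCoded

/-! ### Volume estimate: coded sets have holes -/

namespace IsCoded

open MeasureTheory

/-- Near every cylinder of a coded set there is a hole, of size comparable to the cylinder. -/
theorem exists_hole {E : Type*} [NormedAddCommGroup E] [NormedSpace ℝ E] [Nontrivial E]
    {P : Set E} (hP : P.Nonempty) (hb : Bornology.IsBounded P) {δ : ℝ} (hδ : 0 ≤ δ) :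
    ∃ z, Metric.infDist z P = δ := by
  obtain ⟨p, hp⟩ := hP
  obtain ⟨R, hR⟩ := hb.subset_closedBall p
  obtain ⟨v, hv⟩ := NormedSpace.exists_lt_norm ℝ E (R + δ)
  refine mem_range_of_exists_le_of_exists_ge (Metric.continuous_infDist_pt P)
    ⟨p, by rw [Metric.infDist_zero_of_mem hp]; exact hδ⟩ ⟨p + v, ?_⟩
  refine (Metric.le_infDist ⟨p, hp⟩).2 fun q hq => ?_
  have h1 : dist q p ≤ R := hR hq
  have h2 : dist (p + v) p = ‖v‖ := by simp [dist_eq_norm]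
  have h3 := dist_triangle (p + v) q p
  linarith

theorem dist_lt_of_mem_ball_hole {E : Type*} [PseudoMetricSpace E] {P : Set E}
    (hP : P.Nonempty) {δ : ℝ} {y z : E} (hz : Metric.infDist z P = 2 * δ)
    (hy : y ∈ Metric.ball z δ) : ∃ p ∈ P, dist y p < 3 * δ := by
  rw [← Metric.infDist_lt_iff hP]
  have := Metric.infDist_le_infDist_add_dist (s := P) (x := y) (y := z)
  have h2 : dist y z < δ := hy
  linarith

theorem lt_dist_of_mem_ball_hole {E : Type*} [PseudoMetricSpace E] {P : Set E}
    {δ : ℝ} {y z p : E} (hz : Metric.infDist z P = 2 * δ)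
    (hy : y ∈ Metric.ball z δ) (hp : p ∈ P) : δ < dist y p := by
  have h1 := Metric.infDist_le_dist_of_mem (x := z) hp
  have h2 : dist y z < δ := hy
  have h3 := dist_triangle z y p
  rw [dist_comm z y] at h3
  linarith

/-- Volume estimate: a coded subset of `ℝᵈ` has similarity dimension less than `d`. -/
theorem card_mul_pow_lt_one {d m : ℕ} {r : ℝ} (hd : 0 < d) (hm : 0 < m) (hr0 : 0 < r)
    (hr1 : r < 1) {K : Set (EuclideanSpace ℝ (Fin d))} (h : IsCoded K (Fin m) r) :
    m * r ^ d < 1 := by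
  by_contra! hcon
  have : Nonempty (Fin d) := ⟨⟨0, hd⟩⟩
  have : Nonempty (Fin m) := ⟨⟨0, hm⟩⟩
  obtain ⟨f, c, C, hc, hC, hf⟩ := h
  -- Only levels that are multiples of `j` are used, so that the holes shrink by more than a factor
  -- `3` from one to the next.
  obtain ⟨j, hj⟩ := exists_pow_lt_of_lt_one (by norm_num : (0:ℝ) < 1 / 3) hr1
  let P : (n : ℕ) → (Fin n → Fin m) → Set (EuclideanSpace ℝ (Fin d)) :=
    fun n a => Subtype.val '' {x : K | ∀ i : Fin n, f x i = a i}
  have hPK : ∀ n a, P n a ⊆ K := by rintro n a _ ⟨x, -, rfl⟩; exact x.2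
  have hPne : ∀ n a, (P n a).Nonempty := by
    intro n a
    refine ⟨_, f.symm (fun i => if hi : i < n then a ⟨i, hi⟩ else Classical.arbitrary _), ?_, rfl⟩
    intro i
    simp
  have hdiam : ∀ x ∈ K, ∀ y ∈ K, dist x y ≤ C := fun x hx y hy => by
    have := (hf 0 ⟨x, hx⟩ ⟨y, hy⟩).1 (by simp)
    rwa [pow_zero, mul_one] at this
  have hKb : Bornology.IsBounded K := Metric.isBounded_iff.2 ⟨C, fun x hx y hy => hdiam x hx y hy⟩
  have hsep : ∀ n a p q, p ∈ P n a → q ∈ K → q ∉ P n a → c * r ^ n ≤ dist p q := by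
    rintro n a _ q ⟨x, hx, rfl⟩ hq hqP
    have : ∃ i : Fin n, f ⟨q, hq⟩ i ≠ a i := by
      by_contra! hall
      exact hqP ⟨⟨q, hq⟩, hall, rfl⟩
    obtain ⟨i, hi⟩ := this
    exact (hf n x ⟨q, hq⟩).2 ⟨i, i.2, by rw [hx i]; exact hi.symm⟩
  -- With `δ = c r ^ n / 8`, cylinders of level `n` are `8δ` apart. Points of the ball of radius `δ`
  -- around `z` are between `δ` and `3δ` from their own cylinder, hence more than `5δ` from the
  -- others; this separates balls of one level and keeps each ball more than `δ` from `K`.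
  choose z hz using fun n a => exists_hole (hPne n a) (hKb.subset (hPK n a))
    (show 0 ≤ 2 * (c * r ^ n / 8) by positivity)
  let H : (n : ℕ) → (Fin n → Fin m) → Set (EuclideanSpace ℝ (Fin d)) :=
    fun n a => Metric.ball (z n a) (c * r ^ n / 8)
  have hin : ∀ n a, ∀ y ∈ H n a, ∃ p ∈ P n a, dist y p < 3 * (c * r ^ n / 8) :=
    fun n a y hy => dist_lt_of_mem_ball_hole (hPne n a) (hz n a) hy
  have hout : ∀ n a, ∀ y ∈ H n a, ∀ p ∈ K, c * r ^ n / 8 < dist y p := by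
    intro n a y hy p hp
    by_cases hpP : p ∈ P n a
    · exact lt_dist_of_mem_ball_hole (hz n a) hy hpP
    · obtain ⟨q, hq, hyq⟩ := hin n a y hy
      have h1 := hsep n a q p hq hp hpP
      have h2 := dist_triangle q y p
      rw [dist_comm q y] at h2
      have : 0 < c * r ^ n := by positivity
      linarith
  have hlev : ∀ i i' : ℕ, i < i' → ∀ a a', Disjoint (H (j * i) a) (H (j * i') a') := by
    intro i i' hii a a'
    refine Set.disjoint_left.2 fun y hy hy' => ?_
    obtain ⟨p, hp, hyp⟩ := hin _ _ y hy'
    have h1 := hout _ _ y hy p (hPK _ _ hp)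
    have h2 : r ^ (j * i') ≤ r ^ (j * i) * (1 / 3) := by
      calc r ^ (j * i') ≤ r ^ (j * i + j) :=
            pow_le_pow_of_le_one hr0.le hr1.le
              (by rw [← Nat.mul_succ]; exact Nat.mul_le_mul_left j hii)
        _ = r ^ (j * i) * r ^ j := pow_add _ _ _
        _ ≤ _ := by gcongr
    have h3 := mul_le_mul_of_nonneg_left h2 hc.le
    linarith
  have hsame : ∀ n a a', a ≠ a' → Disjoint (H n a) (H n a') := by
    intro n a a' haa
    refine Set.disjoint_left.2 fun y hy hy' => ?_
    obtain ⟨p, hp, hyp⟩ := hin _ _ y hy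
    obtain ⟨q, hq, hyq⟩ := hin _ _ y hy'
    have hqP : q ∉ P n a := by
      rintro ⟨x, hx, rfl⟩
      obtain ⟨x', hx', he⟩ := hq
      obtain rfl := Subtype.ext he
      exact haa (funext fun i => (hx i).symm.trans (hx' i))
    have h1 := hsep n a p q hp (hPK _ _ hq) hqP
    have h2 := dist_triangle p y q
    rw [dist_comm p y] at h2
    have : 0 < c * r ^ n := by positivity
    linarith
  obtain ⟨x₀, hx₀⟩ := hPne 0 Fin.elim0
  have hx₀K := hPK _ _ hx₀
  have hsub : ∀ n a, H n a ⊆ Metric.closedBall x₀ (C + c) := by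
    intro n a y hy
    obtain ⟨p, hp, hyp⟩ := hin _ _ y hy
    have h1 := hdiam p (hPK _ _ hp) x₀ hx₀K
    have h2 := dist_triangle y p x₀
    have h3 : c * r ^ n ≤ c * 1 := by gcongr; exact pow_le_one₀ hr0.le hr1.le
    rw [Metric.mem_closedBall]
    have : 0 < c * r ^ n := by positivity
    linarith
  set V := (volume : Measure (EuclideanSpace ℝ (Fin d))).real (Metric.closedBall x₀ (C + c))
  set v := (volume : Measure (EuclideanSpace ℝ (Fin d))).real (Metric.ball 0 1)
  have hv : 0 < v := ENNReal.toReal_pos (Metric.measure_ball_pos _ _ one_pos).ne'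
    measure_ball_lt_top.ne
  have hvol : ∀ n a, (volume : Measure (EuclideanSpace ℝ (Fin d))).real (H n a) =
      (c * r ^ n / 8) ^ d * v := by
    intro n a
    simp only [H, v, measureReal_def]
    rw [Measure.addHaar_ball _ _ (by positivity), ENNReal.toReal_mul, finrank_euclideanSpace_fin,
      ENNReal.toReal_ofReal (by positivity)]
  -- At level `n` the holes have total volume `(m r ^ d) ^ n * ((c / 8) ^ d * v)`, which under
  -- `hcon` is bounded below independently of `n`; infinitely many disjoint levels cannot fit into a
  -- ball.
  have hmain : ∀ N : ℕ, N * ((c / 8) ^ d * v) ≤ V := by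
    intro N
    let I := Σ i : Fin N, (Fin (j * i) → Fin m)
    have hdisj : Pairwise fun t t' : I => Disjoint (H (j * t.1) t.2) (H (j * t'.1) t'.2) := by
      rintro ⟨i, a⟩ ⟨i', a'⟩ hne
      rcases lt_trichotomy i i' with hlt | rfl | hlt
      · exact hlev _ _ hlt _ _
      · exact hsame _ _ _ (fun he : a = a' => hne (by rw [he]))
      · exact (hlev _ _ hlt _ _).symm
    have hle : (volume : Measure (EuclideanSpace ℝ (Fin d))).real
        (⋃ t ∈ (Finset.univ : Finset I), H (j * t.1) t.2) ≤ V :=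
      measureReal_mono (Set.iUnion₂_subset fun t _ => hsub _ _)
        measure_closedBall_lt_top.ne
    rw [measureReal_biUnion_finset (fun t _ t' _ hne => hdisj hne)
      (fun t _ => Metric.isOpen_ball.measurableSet)] at hle
    refine le_trans ?_ hle
    simp only [hvol]
    rw [Fintype.sum_sigma]
    calc (N : ℝ) * ((c / 8) ^ d * v) = ∑ _i : Fin N, (c / 8) ^ d * v := by simp
      _ ≤ _ := by
        refine Finset.sum_le_sum fun i _ => ?_
        simp only [Finset.sum_const, Finset.card_univ, Fintype.card_fun, Fintype.card_fin,
          nsmul_eq_mul, Nat.cast_pow]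
        have h1 : (1:ℝ) ≤ (m * r ^ d) ^ (j * (i:ℕ)) := one_le_pow₀ hcon
        calc (c / 8) ^ d * v ≤ (m * r ^ d) ^ (j * (i:ℕ)) * ((c / 8) ^ d * v) :=
              le_mul_of_one_le_left (by positivity) h1
          _ = _ := by
            rw [mul_pow, ← pow_mul, mul_comm d, pow_mul, mul_div_right_comm, mul_pow]
            ring
  obtain ⟨N, hN⟩ := exists_nat_gt (V / ((c / 8) ^ d * v))
  have h1 := hmain N
  rw [div_lt_iff₀ (by positivity)] at hN
  linarith

end IsCoded

/-! ### Dust-like sets on a grid -/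

/-- If `m r^d < 1`, then for some `k` there are `m ^ k` points in a `d`-dimensional grid whose mesh
is finer than `r ^ k`. -/
theorem exists_grid {d m : ℕ} {r : ℝ} (hd : 0 < d) (hr0 : 0 < r) (hr1 : r < 1)
    (h : m * r ^ d < 1) : ∃ k N : ℕ, 0 < k ∧ 0 < N ∧ N * r ^ k < 1 ∧ m ^ k ≤ N ^ d := by
  set μ : ℝ := (m : ℝ) ^ (1 / d : ℝ)
  have hμ0 : 0 ≤ μ := by positivity
  have hμ : μ ^ d = m := by
    rw [← Real.rpow_natCast, ← Real.rpow_mul (by positivity)]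
    simp [hd.ne']
  have hμr : μ * r < 1 := by
    refine lt_of_pow_lt_pow_left₀ d zero_le_one ?_
    rwa [mul_pow, hμ, one_pow]
  obtain ⟨a, ha⟩ := exists_pow_lt_of_lt_one (by norm_num : (0:ℝ) < 1 / 3) hμr
  obtain ⟨b, hb⟩ := exists_pow_lt_of_lt_one (by norm_num : (0:ℝ) < 1 / 3) hr1
  set k := a + b + 1
  have h1 : (μ * r) ^ k < 1 / 3 :=
    (pow_le_pow_of_le_one (by positivity) hμr.le (by omega)).trans_lt ha
  have h2 : r ^ k < 1 / 3 := (pow_le_pow_of_le_one hr0.le hr1.le (by omega)).trans_lt hb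
  -- `N` is the least integer above `μ ^ k`, where `μ = m ^ (1 / d)`; then `N r ^ k ≤ (μ r) ^ k + r
  -- ^ k < 2 / 3`.
  refine ⟨k, ⌊μ ^ k⌋₊ + 1, by omega, by omega, ?_, ?_⟩
  · push_cast
    have h3 : (⌊μ ^ k⌋₊ : ℝ) ≤ μ ^ k := Nat.floor_le (by positivity)
    rw [mul_pow] at h1
    have : (⌊μ ^ k⌋₊ : ℝ) * r ^ k ≤ μ ^ k * r ^ k := by gcongr
    linarith
  · have h3 : μ ^ k < ⌊μ ^ k⌋₊ + 1 := Nat.lt_floor_add_one _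
    have h4 : (m : ℝ) ^ k ≤ ((⌊μ ^ k⌋₊ + 1 : ℕ) : ℝ) ^ d := by
      rw [← hμ, ← pow_mul, mul_comm, pow_mul]
      push_cast
      gcongr
    exact_mod_cast h4

/-- The sequence `i, ω 0, ω 1, …`. -/
def seqCons {ι : Type*} (i : ι) (ω : ℕ → ι) : ℕ → ι
  | 0 => i
  | j + 1 => ω j

namespace EqualRatioIFS

section Coding

variable {d n : ℕ} {s : ℝ}

/-- The coding map `ω ↦ ∑ s ^ j t_{ω j}` of the translation system `x ↦ s x + t_i`. -/
noncomputable def codingMap (s : ℝ) (t : Fin n → EuclideanSpace ℝ (Fin d)) (ω : ℕ → Fin n) :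
    EuclideanSpace ℝ (Fin d) :=
  ∑' j, s ^ j • t (ω j)

/-- The system of the maps `x ↦ s x + t_i`. -/
noncomputable def ofShifts (s : ℝ) (t : Fin n → EuclideanSpace ℝ (Fin d)) :
    EqualRatioIFS d n s where
  rot _ := LinearIsometryEquiv.refl ℝ _
  shift := t

variable (t : Fin n → EuclideanSpace ℝ (Fin d))

theorem norm_codingMap_term_le (hs0 : 0 ≤ s) (ω : ℕ → Fin n) (j : ℕ) :
    ‖s ^ j • t (ω j)‖ ≤ s ^ j * ∑ i, ‖t i‖ := by
  rw [norm_smul, Real.norm_of_nonneg (by positivity)]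
  gcongr
  exact Finset.single_le_sum (f := fun i => ‖t i‖) (fun _ _ => norm_nonneg _) (Finset.mem_univ _)

theorem summable_codingMap_bound (hs0 : 0 ≤ s) (hs1 : s < 1) :
    Summable fun j => s ^ j * ∑ i, ‖t i‖ :=
  (summable_geometric_of_lt_one hs0 hs1).mul_right _

theorem summable_codingMap (hs0 : 0 ≤ s) (hs1 : s < 1) (ω : ℕ → Fin n) :
    Summable fun j => s ^ j • t (ω j) :=
  Summable.of_norm_bounded (summable_codingMap_bound t hs0 hs1)
    (norm_codingMap_term_le t hs0 ω)

theorem continuous_codingMap (hs0 : 0 ≤ s) (hs1 : s < 1) : Continuous (codingMap s t) := by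
  refine continuous_tsum (fun j => ?_) (summable_codingMap_bound t hs0 hs1)
    (fun j ω => norm_codingMap_term_le t hs0 ω j)
  have hj : Continuous fun ω : ℕ → Fin n => ω j := continuous_apply j
  exact (continuous_of_discreteTopology (f := fun i => s ^ j • t i)).comp hj

theorem codingMap_eq (hs0 : 0 ≤ s) (hs1 : s < 1) (ω : ℕ → Fin n) :
    codingMap s t ω = (ofShifts s t).map (ω 0) (codingMap s t fun j => ω (j + 1)) := by
  have h := (summable_codingMap t hs0 hs1 ω).tsum_eq_zero_add
  simp only [codingMap, map, ofShifts, LinearIsometryEquiv.coe_refl, id]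
  rw [h, pow_zero, one_smul, add_comm, ← tsum_const_smul'']
  simp only [pow_succ', mul_smul]

theorem codingMap_seqCons (hs0 : 0 ≤ s) (hs1 : s < 1) (i : Fin n) (ω : ℕ → Fin n) :
    codingMap s t (seqCons i ω) = (ofShifts s t).map i (codingMap s t ω) :=
  codingMap_eq t hs0 hs1 _

theorem isSelfSimilarSet_range_codingMap [NeZero n] (hs0 : 0 ≤ s) (hs1 : s < 1) :
    (ofShifts s t).IsSelfSimilarSet (Set.range (codingMap s t)) where
  nonempty := Set.range_nonempty _
  isCompact := isCompact_range (continuous_codingMap t hs0 hs1)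
  eq_iUnion := by
    ext x
    simp only [Set.mem_iUnion, Set.mem_image, Set.mem_range, exists_exists_eq_and]
    constructor
    · rintro ⟨ω, rfl⟩
      exact ⟨ω 0, _, (codingMap_eq t hs0 hs1 ω).symm⟩
    · rintro ⟨i, ω, rfl⟩
      exact ⟨seqCons i ω, codingMap_seqCons t hs0 hs1 i ω⟩

/-- Equal leading letters contribute the same terms to both series; what remains is a difference of
shifted series, scaled by `s ^ k`. -/
theorem codingMap_sub (hs0 : 0 ≤ s) (hs1 : s < 1) (k : ℕ) :
    ∀ ω ω' : ℕ → Fin n, (∀ i < k, ω i = ω' i) → codingMap s t ω - codingMap s t ω' =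
      s ^ k • (codingMap s t (fun j => ω (j + k)) - codingMap s t fun j => ω' (j + k)) := by
  induction k with
  | zero => intro ω ω' _; simp
  | succ k ih =>
    intro ω ω' h
    rw [ih ω ω' fun i hi => h i (by omega), codingMap_eq t hs0 hs1 fun j => ω (j + k),
      codingMap_eq t hs0 hs1 fun j => ω' (j + k)]
    simp only [zero_add, h k k.lt_succ_self, map, ofShifts, LinearIsometryEquiv.coe_refl, id,
      add_sub_add_right_eq_sub, ← smul_sub, smul_smul, ← pow_succ]
    simp only [add_assoc, add_comm 1 k]

/-- If the first-level cells are uniformly separated, the range of the coding map is a dust-like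
self-similar set, coded by the coding map. -/
theorem exists_isDustLike_of_separated [NeZero n] (hs0 : 0 < s) (hs1 : s < 1) {δ : ℝ} (hδ : 0 < δ)
    (h : ∀ ω ω' : ℕ → Fin n, ω 0 ≠ ω' 0 → δ ≤ dist (codingMap s t ω) (codingMap s t ω')) :
    (ofShifts s t).IsDustLike (Set.range (codingMap s t)) ∧
      IsCoded (Set.range (codingMap s t)) (Fin n) s := by
  have hsep : ∀ k, ∀ ω ω' : ℕ → Fin n, (∀ i < k, ω i = ω' i) → ω k ≠ ω' k →
      s ^ k * δ ≤ dist (codingMap s t ω) (codingMap s t ω') := by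
    intro k ω ω' hk hne
    rw [dist_eq_norm, codingMap_sub t hs0.le hs1 k ω ω' hk, norm_smul,
      Real.norm_of_nonneg (by positivity), ← dist_eq_norm]
    gcongr
    exact h _ _ (by simpa using hne)
  have hinj : Function.Injective (codingMap s t) := by
    intro ω ω' he
    by_contra hne
    obtain ⟨k, hk, hk'⟩ := exists_first_ne hne
    have h1 := hsep k ω ω' hk hk'
    rw [he, dist_self] at h1
    have : 0 < s ^ k * δ := by positivity
    linarith
  have hself := isSelfSimilarSet_range_codingMap t hs0.le hs1
  refine ⟨⟨hself, fun i j hij => Set.disjoint_left.2 ?_⟩, ?_⟩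
  · rintro _ ⟨_, ⟨ω, rfl⟩, rfl⟩ ⟨_, ⟨ω', rfl⟩, he⟩
    have h1 := h (seqCons i ω) (seqCons j ω') hij
    rw [codingMap_seqCons t hs0.le hs1, codingMap_seqCons t hs0.le hs1, he, dist_self] at h1
    linarith
  · obtain ⟨D, hD⟩ := Metric.isBounded_iff.1 hself.isCompact.isBounded
    obtain ⟨e, he⟩ : ∃ e : (ℕ → Fin n) ≃ Set.range (codingMap s t),
      ∀ ω, (e ω : EuclideanSpace ℝ (Fin d)) = codingMap s t ω :=
      ⟨Equiv.ofInjective _ hinj, fun _ => rfl⟩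
    -- The bound `D` on distances may be zero, while the constant has to be positive.
    refine ⟨e.symm, δ, max D 1, hδ, by positivity, fun k x y => ?_⟩
    obtain ⟨ω, rfl⟩ := e.surjective x
    obtain ⟨ω', rfl⟩ := e.surjective y
    simp only [Equiv.symm_apply_apply, Subtype.dist_eq, he]
    constructor
    · intro hk
      rw [dist_eq_norm, codingMap_sub t hs0.le hs1 k ω ω' hk, norm_smul,
        Real.norm_of_nonneg (by positivity), ← dist_eq_norm, mul_comm]
      gcongr
      exact (hD (Set.mem_range_self _) (Set.mem_range_self _)).trans (le_max_left _ _)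
    · rintro ⟨i, hi, hne⟩
      obtain ⟨j, hj, hj'⟩ := exists_first_ne (fun he => hne (congrFun he i))
      have hji : j ≤ i := by
        by_contra! hlt
        exact hne (hj i hlt)
      calc δ * s ^ k ≤ δ * s ^ j := by
            gcongr ?_ * ?_
            exact pow_le_pow_of_le_one hs0.le hs1.le (hji.trans hi.le)
        _ = s ^ j * δ := mul_comm _ _
        _ ≤ _ := hsep j ω ω' hj hj'

/-- A dust-like set whose first-level cells lie in distinct cells of the grid of mesh `1 / N`. -/
theorem exists_isDustLike_of_grid [NeZero n] (hs0 : 0 < s) (hs1 : s < 1) {N : ℕ} (hN : 0 < N)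
    (hNs : N * s < 1) (hnN : n ≤ N ^ d) :
    ∃ (D : EqualRatioIFS d n s) (L : Set (EuclideanSpace ℝ (Fin d))),
      D.IsDustLike L ∧ IsCoded L (Fin n) s := by
  obtain ⟨g⟩ : Nonempty (Fin n ↪ (Fin d → Fin N)) :=
    Function.Embedding.nonempty_of_card_le (by simpa using hnN)
  let t : Fin n → EuclideanSpace ℝ (Fin d) := fun i => WithLp.toLp 2 fun l => (g i l : ℝ) / N
  have hN' : (0:ℝ) < N := by exact_mod_cast hN
  have hcoord : ∀ ω l, codingMap s t ω l = ∑' j, s ^ j * ((g (ω j) l : ℝ) / N) := by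
    intro ω l
    have := (EuclideanSpace.proj l : EuclideanSpace ℝ (Fin d) →L[ℝ] ℝ).map_tsum
      (summable_codingMap t hs0.le hs1 ω)
    simpa [codingMap, t] using this
  have hbound : ∀ ω l, 0 ≤ codingMap s t ω l ∧ codingMap s t ω l ≤ 1 := by
    intro ω l
    rw [hcoord]
    refine ⟨tsum_nonneg fun j => by positivity, ?_⟩
    -- Since `N s < 1`, the last grid point `(N - 1) / N` is at most `1 - s`; the geometric series
    -- then keeps the set inside the unit cube.
    have hle : ∀ j, s ^ j * ((g (ω j) l : ℝ) / N) ≤ s ^ j * (1 - s) := by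
      intro j
      gcongr
      rw [div_le_iff₀ hN']
      have : ((g (ω j) l : ℕ) : ℝ) + 1 ≤ N := by exact_mod_cast (g (ω j) l).2
      linarith
    have hsum := (summable_geometric_of_lt_one hs0.le hs1).mul_right (1 - s)
    calc _ ≤ ∑' j, s ^ j * (1 - s) :=
          Summable.tsum_le_tsum hle (Summable.of_nonneg_of_le (fun j => by positivity) hle hsum) hsum
      _ = 1 := by
        rw [tsum_mul_right, tsum_geometric_of_lt_one hs0.le hs1,
          inv_mul_cancel₀ (by linarith)]
  -- First-level cells lie in cubes of side `s` with corners on the grid. In a coordinate where two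
  -- corners differ they differ by at least `1 / N`, which leaves a gap `1 / N - s`.
  refine ⟨_, _, exists_isDustLike_of_separated t hs0 hs1 (δ := 1 / N - s) ?_ ?_⟩
  · rw [sub_pos, lt_div_iff₀ hN', mul_comm]
    exact hNs
  · intro ω ω' hne
    obtain ⟨l, hl⟩ := Function.ne_iff.1 (fun he => hne (g.injective he))
    have h1 : dist (codingMap s t ω l) (codingMap s t ω' l) ≤
        dist (codingMap s t ω) (codingMap s t ω') := by
      rw [dist_eq_norm, dist_eq_norm]
      exact PiLp.norm_apply_le (codingMap s t ω - codingMap s t ω') l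
    refine le_trans ?_ h1
    rw [codingMap_eq t hs0.le hs1 ω, codingMap_eq t hs0.le hs1 ω']
    set a := codingMap s t fun j => ω (j + 1)
    set b := codingMap s t fun j => ω' (j + 1)
    have ha : 0 ≤ a l ∧ a l ≤ 1 := hbound _ l
    have hb : 0 ≤ b l ∧ b l ≤ 1 := hbound _ l
    have h2 : ((ofShifts s t).map (ω 0) a) l = s * a l + (g (ω 0) l : ℝ) / N := by
      simp [map, ofShifts, t]
    have h3 : ((ofShifts s t).map (ω' 0) b) l = s * b l + (g (ω' 0) l : ℝ) / N := by
      simp [map, ofShifts, t]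
    rw [h2, h3, Real.dist_eq]
    have h4 : |s * (a l - b l)| ≤ s := by
      rw [abs_mul, abs_of_pos hs0]
      exact mul_le_of_le_one_right hs0.le (abs_le.2 ⟨by linarith, by linarith⟩)
    have h5 : 1 / (N : ℝ) ≤ |((g (ω 0) l : ℝ) - (g (ω' 0) l : ℝ)) / N| := by
      rw [abs_div, abs_of_pos hN']
      gcongr
      have : ((g (ω 0) l : ℕ) : ℤ) - ((g (ω' 0) l : ℕ) : ℤ) ≠ 0 := by
        rw [sub_ne_zero]
        exact_mod_cast fun he => hl (Fin.ext he)
      exact_mod_cast Int.one_le_abs this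
    have h6 := abs_sub_abs_le_abs_sub (((g (ω 0) l : ℝ) - (g (ω' 0) l : ℝ)) / N)
      (-(s * (a l - b l)))
    rw [abs_neg] at h6
    have h7 : s * a l + (g (ω 0) l : ℝ) / N - (s * b l + (g (ω' 0) l : ℝ) / N) =
      ((g (ω 0) l : ℝ) - (g (ω' 0) l : ℝ)) / N - -(s * (a l - b l)) := by ring
    rw [h7]
    linarith

end Coding

end EqualRatioIFS

/-! ### Matching two partition trees -/

/-- A family of states with partitions of `X`, indexed by the children of each state: every point
of `X` has a unique itinerary through the tree of states. -/
structure IsPartitionTree {S X : Type*} [TopologicalSpace X] (s₀ : S) (child : S → S → Prop)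
    (P : S → Set X) : Prop where
  root : P s₀ = Set.univ
  existsUnique : ∀ s, ∀ x ∈ P s, ∃! t, child s t ∧ x ∈ P t
  subset : ∀ s t, child s t → P t ⊆ P s
  nonempty : ∀ s, (P s).Nonempty
  isClosed : ∀ s, IsClosed (P s)
  subsingleton : ∀ a : ℕ → S, a 0 = s₀ → (∀ j, child (a j) (a (j + 1))) →
    (⋂ j, P (a j)).Subsingleton

namespace IsPartitionTree

variable {S X Y : Type*} [TopologicalSpace X] [TopologicalSpace Y] {s₀ : S}
  {child : S → S → Prop} {P : S → Set X} {Q : S → Set Y}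

theorem exists_itinerary (h : IsPartitionTree s₀ child P) (x : X) :
    ∃ a : ℕ → S, a 0 = s₀ ∧ (∀ j, child (a j) (a (j + 1))) ∧ ∀ j, x ∈ P (a j) := by
  choose! F hF using fun s (hs : x ∈ P s) => (h.existsUnique s x hs).exists
  have hmem : ∀ j, x ∈ P (F^[j] s₀) := by
    intro j
    induction j with
    | zero => simp [h.root]
    | succ j ih => rw [Function.iterate_succ_apply']; exact (hF _ ih).2
  refine ⟨fun j => F^[j] s₀, rfl, fun j => ?_, hmem⟩
  simp only [Function.iterate_succ_apply']
  exact (hF _ (hmem j)).1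

theorem itinerary_unique (h : IsPartitionTree s₀ child P) {x : X} {a b : ℕ → S}
    (ha0 : a 0 = s₀) (ha : ∀ j, child (a j) (a (j + 1))) (hax : ∀ j, x ∈ P (a j))
    (hb0 : b 0 = s₀) (hb : ∀ j, child (b j) (b (j + 1))) (hbx : ∀ j, x ∈ P (b j)) : a = b := by
  funext j
  induction j with
  | zero => rw [ha0, hb0]
  | succ j ih =>
    refine (h.existsUnique (a j) x (hax j)).unique ⟨ha j, hax _⟩ ⟨?_, hbx _⟩
    rw [ih]; exact hb j

/-- Cantor's intersection theorem along a branch of the tree. -/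
theorem exists_mem_iInter [CompactSpace X] (h : IsPartitionTree s₀ child P) {a : ℕ → S}
    (ha : ∀ j, child (a j) (a (j + 1))) : ∃ x, ∀ j, x ∈ P (a j) := by
  obtain ⟨x, hx⟩ := IsCompact.nonempty_iInter_of_sequence_nonempty_isCompact_isClosed
    (fun j => P (a j)) (fun j => h.subset _ _ (ha j)) (fun j => h.nonempty _)
    (h.isClosed _).isCompact (fun j => h.isClosed _)
  exact ⟨x, by simpa using hx⟩

/-- Two compact spaces with partition trees over the same tree of states are in bijection, and the
bijection respects the itineraries. -/
theorem exists_equiv [CompactSpace X] [CompactSpace Y] (hP : IsPartitionTree s₀ child P)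
    (hQ : IsPartitionTree s₀ child Q) :
    ∃ f : X ≃ Y, ∀ x x', x ≠ x' → ∃ s t t', child s t ∧ child s t' ∧ t ≠ t' ∧
      x ∈ P t ∧ x' ∈ P t' ∧ f x ∈ Q t ∧ f x' ∈ Q t' := by
  choose a ha0 ha hax using hP.exists_itinerary
  choose b hb0 hb hbx using hQ.exists_itinerary
  -- `f x` is a point of `Y` that follows the itinerary of `x`, and `g` does the same in the other
  -- direction. Itineraries determine points, so the two maps are inverse to each other.
  choose f hf using fun x => hQ.exists_mem_iInter (ha x)
  choose g hg using fun y => hP.exists_mem_iInter (hb y)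
  have hab : ∀ x, b (f x) = a x := fun x =>
    hQ.itinerary_unique (hb0 _) (hb _) (hbx _) (ha0 _) (ha _) (hf x)
  have hba : ∀ y, a (g y) = b y := fun y =>
    hP.itinerary_unique (ha0 _) (ha _) (hax _) (hb0 _) (hb _) (hg y)
  refine ⟨⟨f, g, fun x => ?_, fun y => ?_⟩, fun x x' hxx => ?_⟩
  · refine hP.subsingleton (a x) (ha0 x) (ha x) (Set.mem_iInter.2 fun j => ?_)
      (Set.mem_iInter.2 (hax x))
    rw [← hab]; exact hg _ j
  · refine hQ.subsingleton (b y) (hb0 y) (hb y) (Set.mem_iInter.2 fun j => ?_)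
      (Set.mem_iInter.2 (hbx y))
    rw [← hba]; exact hf _ j
  · have hne : a x ≠ a x' := fun h => hxx <| hP.subsingleton (a x) (ha0 x) (ha x)
      (Set.mem_iInter.2 (hax x)) (Set.mem_iInter.2 fun j => by rw [h]; exact hax x' j)
    obtain ⟨n, hn, hn'⟩ := exists_first_ne hne
    -- Both itineraries start at the root, so the first difference has a predecessor, the common
    -- parent.
    cases n with
    | zero => exact absurd ((ha0 x).trans (ha0 x').symm) hn'
    | succ n =>
      refine ⟨a x n, a x (n + 1), a x' (n + 1), ha x n, ?_, hn', hax _ _, hax _ _, hf _ _, hf _ _⟩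
      rw [hn n n.lt_succ_self]; exact ha x' n

end IsPartitionTree

/-! ### Cells, components and their pieces -/

namespace EqualRatioIFS

variable {d m : ℕ} {r : ℝ} {F : EqualRatioIFS d m r} {J K : Set (EuclideanSpace ℝ (Fin d))}

section Cells

theorem wordMap_append (F : EqualRatioIFS d m r) (u v : List (Fin m)) :
    F.wordMap (u ++ v) = F.wordMap u ∘ F.wordMap v := by
  induction u with
  | nil => rfl
  | cons i u ih => simp [wordMap, ih, Function.comp_assoc]

theorem dist_map (hr : 0 ≤ r) (F : EqualRatioIFS d m r) (i : Fin m)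
    (x y : EuclideanSpace ℝ (Fin d)) : dist (F.map i x) (F.map i y) = r * dist x y := by
  simp [map, dist_smul₀, abs_of_nonneg hr]

theorem dist_wordMap (hr : 0 ≤ r) (F : EqualRatioIFS d m r) (u : List (Fin m))
    (x y : EuclideanSpace ℝ (Fin d)) :
    dist (F.wordMap u x) (F.wordMap u y) = r ^ u.length * dist x y := by
  induction u with
  | nil => simp [wordMap]
  | cons i u ih => simp [wordMap, dist_map hr, ih, pow_succ']; ring

theorem dist_le_of_mem_cell (hr : 0 ≤ r) {A : Set (EuclideanSpace ℝ (Fin d))} {M : ℝ}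
    (hM : ∀ x ∈ A, ∀ y ∈ A, dist x y ≤ M) {u : List (Fin m)} {x y : EuclideanSpace ℝ (Fin d)}
    (hx : x ∈ F.cell A u) (hy : y ∈ F.cell A u) : dist x y ≤ M * r ^ u.length := by
  obtain ⟨x, hx, rfl⟩ := hx
  obtain ⟨y, hy, rfl⟩ := hy
  rw [dist_wordMap hr, mul_comm]
  gcongr
  exact hM x hx y hy

theorem cell_mono {A B : Set (EuclideanSpace ℝ (Fin d))} (h : A ⊆ B) (u : List (Fin m)) :
    F.cell A u ⊆ F.cell B u :=
  Set.image_mono h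

theorem continuous_map (F : EqualRatioIFS d m r) (i : Fin m) : Continuous (F.map i) :=
  (((F.rot i).continuous).const_smul r).add continuous_const

theorem continuous_wordMap (F : EqualRatioIFS d m r) (u : List (Fin m)) :
    Continuous (F.wordMap u) := by
  induction u with
  | nil => exact continuous_id
  | cons i u ih => exact (F.continuous_map i).comp ih

theorem IsInvariantSet.cell_subset (hJ : F.IsInvariantSet J) (u : List (Fin m)) :
    F.cell J u ⊆ J := by
  induction u with
  | nil => simp [cell, wordMap]
  | cons i u ih =>
    rintro _ ⟨x, hx, rfl⟩
    exact hJ.image_subset i ⟨_, ih ⟨x, hx, rfl⟩, rfl⟩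

theorem IsInvariantSet.cell_append_subset (hJ : F.IsInvariantSet J) (u v : List (Fin m)) :
    F.cell J (u ++ v) ⊆ F.cell J u := by
  rintro _ ⟨x, hx, rfl⟩
  rw [wordMap_append]
  exact ⟨_, hJ.cell_subset v ⟨x, hx, rfl⟩, rfl⟩

theorem IsInvariantSet.cell_subset_take (hJ : F.IsInvariantSet J) (n : ℕ) (w : List (Fin m)) :
    F.cell J w ⊆ F.cell J (w.take n) := by
  conv_lhs => rw [← List.take_append_drop n w]
  exact hJ.cell_append_subset _ _

theorem IsInvariantSet.exists_dist_le (hJ : F.IsInvariantSet J) :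
    ∃ M : ℝ, 0 < M ∧ ∀ x ∈ J, ∀ y ∈ J, dist x y ≤ M := by
  obtain ⟨M, hM⟩ := Metric.isBounded_iff.1 hJ.isBounded
  exact ⟨max M 1, by positivity, fun x hx y hy => (hM hx hy).trans (le_max_left _ _)⟩

theorem IsSelfSimilarSet.isInvariantSet (hK : F.IsSelfSimilarSet K) : F.IsInvariantSet K where
  nonempty := hK.nonempty
  isClosed := hK.isCompact.isClosed
  isBounded := hK.isCompact.isBounded
  image_subset i := by
    conv_rhs => rw [hK.eq_iUnion]
    exact Set.subset_iUnion (fun i => F.map i '' K) i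

theorem IsSelfSimilarSet.exists_mem_cell (hK : F.IsSelfSimilarSet K) (k : ℕ) :
    ∀ x ∈ K, ∃ v : List (Fin m), v.length = k ∧ x ∈ F.cell K v := by
  induction k with
  | zero => intro x hx; exact ⟨[], rfl, x, hx, rfl⟩
  | succ k ih =>
    intro x hx
    rw [hK.eq_iUnion] at hx
    obtain ⟨i, y, hy, rfl⟩ := Set.mem_iUnion.1 hx
    obtain ⟨v, hv, z, hz, rfl⟩ := ih y hy
    exact ⟨i :: v, by simp [hv], z, hz, rfl⟩

theorem IsSelfSimilarSet.exists_mem_cell_append (hK : F.IsSelfSimilarSet K) (k : ℕ)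
    {u : List (Fin m)} {x : EuclideanSpace ℝ (Fin d)} (hx : x ∈ F.cell K u) :
    ∃ v : List (Fin m), v.length = k ∧ x ∈ F.cell K (u ++ v) := by
  obtain ⟨y, hy, rfl⟩ := hx
  obtain ⟨v, hv, z, hz, rfl⟩ := hK.exists_mem_cell k y hy
  exact ⟨v, hv, z, hz, by rw [wordMap_append]; rfl⟩

/-- A point `S_v z` of `K`, with `v` of length `n`, is within `r ^ n * dist z j` of the point `S_v
j` of `J`, and `J` is closed. -/
theorem IsSelfSimilarSet.subset_isInvariantSet (hr0 : 0 < r) (hr1 : r < 1)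
    (hK : F.IsSelfSimilarSet K) (hJ : F.IsInvariantSet J) : K ⊆ J := by
  intro x hx
  obtain ⟨j, hj⟩ := hJ.nonempty
  obtain ⟨R, hR⟩ := hK.isCompact.isBounded.subset_closedBall j
  rw [← hJ.isClosed.closure_eq]
  refine Metric.mem_closure_iff.2 fun ε hε => ?_
  have hR0 : 0 ≤ R := dist_nonneg.trans (hR hx)
  obtain ⟨n, hn⟩ := exists_pow_lt_of_lt_one (show 0 < ε / (R + 1) by positivity) hr1
  obtain ⟨v, rfl, z, hz, rfl⟩ := hK.exists_mem_cell n x hx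
  refine ⟨F.wordMap v j, hJ.cell_subset v ⟨j, hj, rfl⟩, ?_⟩
  rw [dist_wordMap hr0.le]
  rw [lt_div_iff₀ (by positivity)] at hn
  have h1 : dist z j ≤ R := hR hz
  have h2 : 0 < r ^ v.length := by positivity
  nlinarith

end Cells

section Components

theorem length_eq_of_reachable {u v : List (Fin m)} (h : (F.horizontal J).Reachable u v) :
    u.length = v.length := by
  obtain ⟨p⟩ := h
  induction p with
  | nil => rfl
  | cons h _ ih => exact h.2.1.trans ih

theorem reachable_of_inter {u v : List (Fin m)} (hl : u.length = v.length)
    (h : (F.cell J u ∩ F.cell J v).Nonempty) : (F.horizontal J).Reachable u v := by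
  by_cases huv : u = v
  · rw [huv]
  · exact SimpleGraph.Adj.reachable ⟨huv, hl, h⟩

/-- Cells of `J` decrease along the tree, so ancestors of words with intersecting cells have
intersecting cells. Consequently the descendants of a component at a given depth are a union of
whole components. -/
theorem IsInvariantSet.reachable_take (hJ : F.IsInvariantSet J) (n : ℕ) {u v : List (Fin m)}
    (h : (F.horizontal J).Reachable u v) :
    (F.horizontal J).Reachable (u.take n) (v.take n) := by
  obtain ⟨p⟩ := h
  induction p with
  | nil => rfl
  | cons h _ ih =>
    refine (reachable_of_inter (by simp [h.2.1]) ?_).trans ih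
    exact h.2.2.mono (Set.inter_subset_inter (hJ.cell_subset_take n _) (hJ.cell_subset_take n _))

/-- The level of a horizontal component: the common length of its words. -/
noncomputable def level (T : F.Component J) : ℕ := T.nonempty_supp.some.length

theorem reachable_of_mem {T : F.Component J} {u v : List (Fin m)} (hu : u ∈ T.supp)
    (hv : v ∈ T.supp) : (F.horizontal J).Reachable u v :=
  T.reachable_of_mem_supp hu hv

theorem length_of_mem {T : F.Component J} {u : List (Fin m)} (hu : u ∈ T.supp) :
    u.length = level T :=
  length_eq_of_reachable (reachable_of_mem hu T.nonempty_supp.some_mem)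

theorem mem_of_reachable {T : F.Component J} {u v : List (Fin m)} (hu : u ∈ T.supp)
    (h : (F.horizontal J).Reachable u v) : v ∈ T.supp := by
  rw [SimpleGraph.ConnectedComponent.mem_supp_iff] at hu ⊢
  rw [← hu]
  exact SimpleGraph.ConnectedComponent.sound h.symm

theorem finite_supp (T : F.Component J) : T.supp.Finite :=
  (List.finite_length_eq (Fin m) (level T)).subset fun _ => length_of_mem

theorem ncard_supp_pos (T : F.Component J) : 0 < T.supp.ncard :=
  (Set.ncard_pos (finite_supp T)).2 T.nonempty_supp

/-- The words `u v` with `u` in `T` and `v` of length `k`. -/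
def descendants (T : F.Component J) (k : ℕ) : Set (List (Fin m)) :=
  {w | w.length = level T + k ∧ w.take (level T) ∈ T.supp}

theorem append_mem_descendants {T : F.Component J} {u v : List (Fin m)} (hu : u ∈ T.supp) :
    u ++ v ∈ descendants T v.length := by
  have := length_of_mem hu
  exact ⟨by simp [this], by rw [← this, List.take_left]; exact hu⟩

theorem mem_descendants_iff {T : F.Component J} {k : ℕ} {w : List (Fin m)} :
    w ∈ descendants T k ↔ ∃ u ∈ T.supp, ∃ v : List (Fin m), v.length = k ∧ w = u ++ v := by
  constructor
  · rintro ⟨h1, h2⟩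
    exact ⟨_, h2, w.drop (level T), by simp [h1], (List.take_append_drop _ _).symm⟩
  · rintro ⟨u, hu, v, rfl, rfl⟩
    exact append_mem_descendants hu

theorem offspring_eq (T : F.Component J) : offspring T = descendants T 1 := by
  ext w
  rw [mem_descendants_iff]
  simp only [offspring, Set.mem_ofPred_eq, List.length_eq_one_iff]
  constructor
  · rintro ⟨u, hu, i, rfl⟩
    exact ⟨u, hu, [i], ⟨i, rfl⟩, rfl⟩
  · rintro ⟨u, hu, _, ⟨i, rfl⟩, rfl⟩
    exact ⟨u, hu, i, rfl⟩

theorem finite_descendants (T : F.Component J) (k : ℕ) : (descendants T k).Finite :=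
  (List.finite_length_eq (Fin m) (level T + k)).subset fun _ h => h.1

theorem IsInvariantSet.mem_descendants_of_reachable (hJ : F.IsInvariantSet J) {T : F.Component J}
    {k : ℕ} {w w' : List (Fin m)} (hw : w ∈ descendants T k)
    (h : (F.horizontal J).Reachable w w') : w' ∈ descendants T k :=
  ⟨(length_eq_of_reachable h).symm.trans hw.1, mem_of_reachable hw.2 (hJ.reachable_take _ h)⟩

theorem IsInvariantSet.supp_subset_descendants (hJ : F.IsInvariantSet J) {T Z : F.Component J}
    {k : ℕ} {w : List (Fin m)} (hw : w ∈ Z.supp) (hw' : w ∈ descendants T k) :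
    Z.supp ⊆ descendants T k :=
  fun _ hv => hJ.mem_descendants_of_reachable hw' (reachable_of_mem hw hv)

theorem level_of_subset {T Z : F.Component J} {k : ℕ} (h : Z.supp ⊆ descendants T k) :
    level Z = level T + k := by
  obtain ⟨w, hw⟩ := Z.nonempty_supp
  rw [← length_of_mem hw, (h hw).1]

theorem ncard_setOf_length_eq (m k : ℕ) : {v : List (Fin m) | v.length = k}.ncard = m ^ k := by
  have : Nat.card (List.Vector (Fin m) k) = m ^ k := by simp [Nat.card_eq_fintype_card]
  exact this

theorem ncard_descendants (T : F.Component J) (k : ℕ) :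
    (descendants T k).ncard = T.supp.ncard * m ^ k := by
  have h1 : descendants T k = (fun p : List (Fin m) × List (Fin m) => p.1 ++ p.2) ''
      (T.supp ×ˢ {v | v.length = k}) := by
    ext w
    rw [mem_descendants_iff]
    simp only [Set.mem_image, Set.mem_prod, Set.mem_ofPred_eq, Prod.exists]
    constructor
    · rintro ⟨u, hu, v, hv, rfl⟩; exact ⟨u, v, ⟨hu, hv⟩, rfl⟩
    · rintro ⟨u, v, ⟨hu, hv⟩, rfl⟩; exact ⟨u, hu, v, hv, rfl⟩
  rw [h1, Set.InjOn.ncard_image, Set.ncard_prod, ncard_setOf_length_eq]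
  rintro ⟨u, v⟩ ⟨hu, -⟩ ⟨u', v'⟩ ⟨hu', -⟩ he
  have := List.append_inj he ((length_of_mem hu).trans (length_of_mem hu').symm)
  exact Prod.ext this.1 this.2

theorem descendants_zero (T : F.Component J) : descendants T 0 = T.supp := by
  ext w
  simp [mem_descendants_iff]

theorem descendants_subset_of_subset {T Z : F.Component J} {j k : ℕ}
    (h : Z.supp ⊆ descendants T j) : descendants Z k ⊆ descendants T (j + k) := by
  intro w hw
  obtain ⟨u, hu, v, hv, rfl⟩ := mem_descendants_iff.1 hw
  obtain ⟨u', hu', v', hv', rfl⟩ := mem_descendants_iff.1 (h hu)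
  exact mem_descendants_iff.2 ⟨u', hu', v' ++ v, by simp [hv, hv'], by simp⟩

/-- The union of the cells `K_u` with `u` in the component `T`. -/
def piece (K : Set (EuclideanSpace ℝ (Fin d))) (T : F.Component J) :
    Set (EuclideanSpace ℝ (Fin d)) :=
  ⋃ u ∈ T.supp, F.cell K u

theorem mem_piece {T : F.Component J} {x : EuclideanSpace ℝ (Fin d)} :
    x ∈ piece K T ↔ ∃ u ∈ T.supp, x ∈ F.cell K u := by
  simp [piece]

theorem isCompact_piece (hK : IsCompact K) (T : F.Component J) : IsCompact (piece K T) :=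
  (finite_supp T).isCompact_biUnion fun u _ => hK.image (F.continuous_wordMap u)

theorem IsInvariantSet.exists_component (hJ : F.IsInvariantSet J) (hK : F.IsSelfSimilarSet K)
    {T : F.Component J} {x : EuclideanSpace ℝ (Fin d)} (hx : x ∈ piece K T) (k : ℕ) :
    ∃ Z : F.Component J, Z.supp ⊆ descendants T k ∧ x ∈ piece K Z := by
  obtain ⟨u, hu, hxu⟩ := mem_piece.1 hx
  obtain ⟨v, rfl, hv⟩ := hK.exists_mem_cell_append k hxu
  have hmem : u ++ v ∈ ((F.horizontal J).connectedComponentMk (u ++ v)).supp := rfl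
  exact ⟨_, hJ.supp_subset_descendants hmem (append_mem_descendants hu), mem_piece.2 ⟨_, hmem, hv⟩⟩

theorem eq_of_cell_inter (hKJ : K ⊆ J) {T T' : F.Component J} (hl : level T = level T')
    {u v : List (Fin m)} (hu : u ∈ T.supp) (hv : v ∈ T'.supp)
    (h : (F.cell K u ∩ F.cell K v).Nonempty) : T = T' := by
  have h1 : (F.horizontal J).Reachable u v :=
    reachable_of_inter (by rw [length_of_mem hu, length_of_mem hv, hl])
      (h.mono (Set.inter_subset_inter (cell_mono hKJ _) (cell_mono hKJ _)))
  exact SimpleGraph.ConnectedComponent.eq_of_common_vertex (mem_of_reachable hu h1) hv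

theorem eq_of_mem_piece (hKJ : K ⊆ J) {T T' : F.Component J} (hl : level T = level T')
    {x : EuclideanSpace ℝ (Fin d)} (hx : x ∈ piece K T) (hx' : x ∈ piece K T') : T = T' := by
  obtain ⟨u, hu, hxu⟩ := mem_piece.1 hx
  obtain ⟨v, hv, hxv⟩ := mem_piece.1 hx'
  exact eq_of_cell_inter hKJ hl hu hv ⟨x, hxu, hxv⟩

/-- Consecutive cells of the walk share a point, so each vertex costs at most one cell diameter. -/
theorem dist_le_of_walk (hr : 0 ≤ r) {M : ℝ} (hM : ∀ x ∈ J, ∀ y ∈ J, dist x y ≤ M)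
    {u v : List (Fin m)} (p : (F.horizontal J).Walk u v) {x y : EuclideanSpace ℝ (Fin d)}
    (hx : x ∈ F.cell J u) (hy : y ∈ F.cell J v) :
    dist x y ≤ p.support.length * (M * r ^ u.length) := by
  induction p generalizing x with
  | nil => simpa using dist_le_of_mem_cell hr hM hx hy
  | cons h p ih =>
    obtain ⟨z, hz, hz'⟩ := h.2.2
    have h1 := dist_le_of_mem_cell hr hM hx hz
    have h2 := ih hz' hy
    have h3 := dist_triangle x z y
    rw [← h.2.1] at h2
    simp only [SimpleGraph.Walk.support_cons, List.length_cons, Nat.cast_add, Nat.cast_one]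
    linarith

/-- Two words of the component are joined by a path without repetitions, which visits at most `#T`
cells. -/
theorem dist_le_of_mem_piece (hr : 0 ≤ r) {M : ℝ} (hM0 : 0 ≤ M)
    (hM : ∀ x ∈ J, ∀ y ∈ J, dist x y ≤ M) (hKJ : K ⊆ J) {T : F.Component J} {B : ℕ}
    (hB : T.supp.ncard ≤ B) {x y : EuclideanSpace ℝ (Fin d)} (hx : x ∈ piece K T)
    (hy : y ∈ piece K T) : dist x y ≤ B * M * r ^ level T := by
  classical
  obtain ⟨u, hu, hxu⟩ := mem_piece.1 hx
  obtain ⟨v, hv, hyv⟩ := mem_piece.1 hy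
  obtain ⟨p, hp⟩ := (reachable_of_mem hu hv).exists_isPath
  have h1 := dist_le_of_walk hr hM p (cell_mono hKJ _ hxu) (cell_mono hKJ _ hyv)
  have h2 : p.support.length ≤ B := by
    refine le_trans ?_ hB
    rw [← List.toFinset_card_of_nodup hp.support_nodup, ← Set.ncard_coe_finset]
    refine Set.ncard_le_ncard (fun w hw => ?_) (finite_supp T)
    have hw' : w ∈ p.support := by simpa using hw
    exact mem_of_reachable hu ⟨p.takeUntil w hw'⟩
  rw [length_of_mem hu] at h1
  refine h1.trans ?_
  rw [mul_assoc]
  gcongr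

/-- Cells of `K` that meet give cells of `J` that meet, because `K ⊆ J`; so cells from different
components are disjoint and condition (H) applies to them. -/
theorem le_dist_of_mem_piece (hKJ : K ⊆ J) {c : ℝ}
    (hc : ∀ n : ℕ, 1 ≤ n → ∀ u v : List (Fin m), u.length = n → v.length = n →
      Disjoint (F.cell K u) (F.cell K v) →
        ∀ x ∈ F.cell K u, ∀ y ∈ F.cell K v, c * r ^ n ≤ dist x y)
    {T T' : F.Component J} (hne : T ≠ T') (hl : level T = level T') (h1 : 1 ≤ level T)
    {x y : EuclideanSpace ℝ (Fin d)} (hx : x ∈ piece K T) (hy : y ∈ piece K T') :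
    c * r ^ level T ≤ dist x y := by
  obtain ⟨u, hu, hxu⟩ := mem_piece.1 hx
  obtain ⟨v, hv, hyv⟩ := mem_piece.1 hy
  refine hc _ h1 u v (length_of_mem hu) ((length_of_mem hv).trans hl.symm) ?_ x hxu y hyv
  by_contra hdis
  exact hne (eq_of_cell_inter hKJ hl hu hv (Set.not_disjoint_iff_nonempty_inter.1 hdis))

end Components

end EqualRatioIFS

/-! ### Prefixes of sequences -/

/-- The word formed by the first `n` letters of a sequence. -/
def seqPrefix {ι : Type*} (ω : ℕ → ι) (n : ℕ) : List ι := List.ofFn fun i : Fin n => ω i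

section SeqPrefix

variable {ι : Type*}

@[simp] theorem length_seqPrefix (ω : ℕ → ι) (n : ℕ) : (seqPrefix ω n).length = n := by
  simp [seqPrefix]

theorem seqPrefix_eq_iff {ω ω' : ℕ → ι} {n : ℕ} :
    seqPrefix ω n = seqPrefix ω' n ↔ ∀ i < n, ω i = ω' i := by
  rw [seqPrefix, seqPrefix, List.ofFn_inj, funext_iff]
  exact ⟨fun h i hi => h ⟨i, hi⟩, fun h i => h i i.2⟩

theorem seqPrefix_add (ω : ℕ → ι) (n k : ℕ) :
    seqPrefix ω (n + k) = seqPrefix ω n ++ seqPrefix (fun j => ω (n + j)) k := by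
  simp only [seqPrefix, List.ofFn_add]
  rfl

theorem take_seqPrefix (ω : ℕ → ι) {n k : ℕ} (h : k ≤ n) :
    (seqPrefix ω n).take k = seqPrefix ω k := by
  obtain ⟨l, rfl⟩ := Nat.exists_eq_add_of_le h
  rw [seqPrefix_add]
  exact List.take_left' (length_seqPrefix ω k)

theorem exists_seqPrefix_eq [Nonempty ι] (v : List ι) : ∃ ω : ℕ → ι, seqPrefix ω v.length = v := by
  refine ⟨fun j => v.getD j (Classical.arbitrary ι), ?_⟩
  refine List.ext_getElem (by simp) fun i h1 h2 => ?_
  simp [seqPrefix]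

theorem isClosed_setOf_seqPrefix_mem [Finite ι] [TopologicalSpace ι] [DiscreteTopology ι] (n : ℕ)
    (A : Set (List ι)) : IsClosed {ω : ℕ → ι | seqPrefix ω n ∈ A} := by
  have hc : Continuous fun (ω : ℕ → ι) (i : Fin n) => ω i :=
    continuous_pi fun i => continuous_apply (i : ℕ)
  exact (isClosed_discrete {a : Fin n → ι | List.ofFn a ∈ A}).preimage hc

end SeqPrefix

/-! ### From groupings to a coding -/

namespace EqualRatioIFS

variable {d m : ℕ} {r : ℝ} {F : EqualRatioIFS d m r} {J K : Set (EuclideanSpace ℝ (Fin d))}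

/-- The components among the descendants of `T` of depth `k` can be distributed over the words of
`T` in such a way that each word receives exactly `m ^ k` descendants. -/
def HasGrouping (T : F.Component J) (k : ℕ) : Prop :=
  ∃ γ : List (Fin m) → List (Fin m), (∀ w ∈ descendants T k, γ w ∈ T.supp) ∧
    (∀ w ∈ descendants T k, ∀ w', (F.horizontal J).Reachable w w' → γ w = γ w') ∧
    ∀ u ∈ T.supp, {w ∈ descendants T k | γ w = u}.ncard = m ^ k

/-- Data that recode the descendants of `T` of depth `k`: the word `w` is encoded by the word
`γ w` of `T`, which depends on the component of `w` only, and a word `β w` of length `k`. -/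
structure IsRecoding (T : F.Component J) (k : ℕ) (γ β : List (Fin m) → List (Fin m)) : Prop where
  mem : ∀ w ∈ descendants T k, γ w ∈ T.supp
  reachable : ∀ w ∈ descendants T k, ∀ w', (F.horizontal J).Reachable w w' → γ w = γ w'
  bijOn : ∀ u ∈ T.supp, Set.BijOn β {w ∈ descendants T k | γ w = u} {v | v.length = k}

/-- A group of `m ^ k` descendants has as many elements as there are words of length `k`; any
bijection serves as `β`. -/
theorem HasGrouping.exists_isRecoding {T : F.Component J} {k : ℕ} (h : HasGrouping T k) :
    ∃ γ β, IsRecoding T k γ β := by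
  obtain ⟨γ, h1, h2, h3⟩ := h
  have h4 : ∀ u, ∃ β : List (Fin m) → List (Fin m), u ∈ T.supp →
      Set.BijOn β {w ∈ descendants T k | γ w = u} {v | v.length = k} := by
    intro u
    by_cases hu : u ∈ T.supp
    · have hfin : {w ∈ descendants T k | γ w = u}.Finite :=
        (finite_descendants T k).subset fun _ h => h.1
      obtain ⟨β, hβ⟩ := hfin.exists_bijOn_of_encard_eq (t := {v : List (Fin m) | v.length = k}) (by
        rw [← hfin.cast_ncard_eq, ← (List.finite_length_eq (Fin m) k).cast_ncard_eq, h3 u hu,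
          ncard_setOf_length_eq])
      exact ⟨β, fun _ => hβ⟩
    · exact ⟨id, fun h => absurd h hu⟩
  choose β hβ using h4
  refine ⟨γ, fun w => β (γ w) w, h1, h2, fun u hu => (hβ u hu).congr ?_⟩
  rintro w ⟨-, rfl⟩
  rfl

namespace IsRecoding

variable {T : F.Component J} {k : ℕ} {γ β : List (Fin m) → List (Fin m)}

theorem length (h : IsRecoding T k γ β) {w : List (Fin m)} (hw : w ∈ descendants T k) :
    (β w).length = k :=
  (h.bijOn _ (h.mem w hw)).mapsTo ⟨hw, rfl⟩

theorem exists_eq (h : IsRecoding T k γ β) {u v : List (Fin m)} (hu : u ∈ T.supp)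
    (hv : v.length = k) : ∃ w ∈ descendants T k, γ w = u ∧ β w = v := by
  obtain ⟨w, ⟨hw, hwu⟩, hwv⟩ := (h.bijOn u hu).surjOn hv
  exact ⟨w, hw, hwu, hwv⟩

theorem ext (h : IsRecoding T k γ β) {w w' : List (Fin m)} (hw : w ∈ descendants T k)
    (hw' : w' ∈ descendants T k) (h1 : γ w = γ w') (h2 : β w = β w') : w = w' :=
  (h.bijOn _ (h.mem w hw)).injOn ⟨hw, rfl⟩ ⟨hw', h1.symm⟩ h2

end IsRecoding

/-- A component together with an encoding of its words by words of the same length, which have a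
common ancestor at most `κ` generations above. -/
@[ext]
structure CodingState (F : EqualRatioIFS d m r) (J : Set (EuclideanSpace ℝ (Fin d))) (κ : ℕ) where
  comp : F.Component J
  enc : List (Fin m) → List (Fin m)
  injOn : Set.InjOn enc comp.supp
  length_enc : ∀ u ∈ comp.supp, (enc u).length = level comp
  common : ∀ u ∈ comp.supp, ∀ v ∈ comp.supp,
    (enc u).take (level comp - κ) = (enc v).take (level comp - κ)

namespace CodingState

variable {κ : ℕ}

/-- The part of `K` covered by a state. -/
def pieceOf (K : Set (EuclideanSpace ℝ (Fin d))) (s : CodingState F J κ) : Set K :=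
  Subtype.val ⁻¹' piece K s.comp

/-- The sequences with a prefix encoded by the state. -/
def cylinder (s : CodingState F J κ) : Set (ℕ → Fin m) :=
  {ω | seqPrefix ω (level s.comp) ∈ s.enc '' s.comp.supp}

/-- The children of a state, given the depth and the recodings attached to each component. -/
def Child (k : F.Component J → ℕ) (γ β : F.Component J → List (Fin m) → List (Fin m))
    (s t : CodingState F J κ) : Prop :=
  t.comp.supp ⊆ descendants s.comp (k s.comp) ∧
    t.enc = fun w => s.enc (γ s.comp w) ++ β s.comp w

theorem agree_of_mem_cylinder {s : CodingState F J κ} {ω ω' : ℕ → Fin m} (h : ω ∈ s.cylinder)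
    (h' : ω' ∈ s.cylinder) : ∀ i < level s.comp - κ, ω i = ω' i := by
  obtain ⟨u, hu, hω⟩ := h
  obtain ⟨v, hv, hω'⟩ := h'
  rw [← seqPrefix_eq_iff, ← take_seqPrefix ω (Nat.sub_le (level s.comp) κ),
    ← take_seqPrefix ω' (Nat.sub_le (level s.comp) κ), ← hω, ← hω']
  exact s.common u hu v hv

section

variable {k : F.Component J → ℕ} {γ β : F.Component J → List (Fin m) → List (Fin m)}

theorem level_child {s t : CodingState F J κ} (h : Child k γ β s t) :
    level t.comp = level s.comp + k s.comp :=
  level_of_subset h.1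

/-- The encodings of the words of the parent have equal length, so the concatenation determines `γ
w` and `β w`, and these determine `w`. -/
theorem enc_inj (hrec : ∀ T, IsRecoding T (k T) (γ T) (β T)) (s : CodingState F J κ)
    {w w' : List (Fin m)} (hw : w ∈ descendants s.comp (k s.comp))
    (hw' : w' ∈ descendants s.comp (k s.comp))
    (h : s.enc (γ s.comp w) ++ β s.comp w = s.enc (γ s.comp w') ++ β s.comp w') : w = w' := by
  have hm := (hrec s.comp).mem w hw
  have hm' := (hrec s.comp).mem w' hw'
  obtain ⟨h1, h2⟩ := List.append_inj h
    ((s.length_enc _ hm).trans (s.length_enc _ hm').symm)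
  exact (hrec s.comp).ext hw hw' (s.injOn hm hm' h1) h2

theorem exists_child (hrec : ∀ T, IsRecoding T (k T) (γ T) (β T)) (hκ : ∀ T, k T ≤ κ)
    (s : CodingState F J κ) {Z : F.Component J} (hZ : Z.supp ⊆ descendants s.comp (k s.comp)) :
    ∃ t : CodingState F J κ, Child k γ β s t ∧ t.comp = Z := by
  have hR := hrec s.comp
  have hlev := level_of_subset hZ
  refine ⟨⟨Z, fun w => s.enc (γ s.comp w) ++ β s.comp w, ?_, ?_, ?_⟩, ⟨hZ, rfl⟩, rfl⟩
  · intro w hw w' hw' h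
    exact enc_inj hrec s (hZ hw) (hZ hw') h
  · intro w hw
    rw [List.length_append, s.length_enc _ (hR.mem w (hZ hw)), hR.length (hZ hw), hlev]
  · intro w hw w' hw'
    -- `γ` is constant on the component `Z`, so all its codes begin with the same code of a word of
    -- `s`, of length `level s.comp`; as `k ≤ κ`, this covers the required prefix.
    have hle : level Z - κ ≤ level s.comp := by have := hκ s.comp; omega
    rw [List.take_append_of_le_length, List.take_append_of_le_length,
      hR.reachable w (hZ hw) w' (reachable_of_mem hw hw')]
    · rwa [s.length_enc _ (hR.mem w' (hZ hw'))]
    · rwa [s.length_enc _ (hR.mem w (hZ hw))]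

theorem child_ext {s t t' : CodingState F J κ} (h : Child k γ β s t) (h' : Child k γ β s t')
    (he : t.comp = t'.comp) : t = t' :=
  CodingState.ext he (h.2.trans h'.2.symm)

theorem le_level (hk : ∀ T, 1 ≤ k T) {a : ℕ → CodingState F J κ}
    (ha : ∀ j, Child k γ β (a j) (a (j + 1))) (j : ℕ) : j ≤ level (a j).comp := by
  induction j with
  | zero => exact Nat.zero_le _
  | succ j ih =>
    have := level_child (ha j)
    have := hk (a j).comp
    omega

/-- Sequences agreeing up to the level of the children would have the same encoded prefix, hence
come from one word, whereas distinct children have disjoint components. -/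
theorem disagree_of_mem_cylinder (hrec : ∀ T, IsRecoding T (k T) (γ T) (β T))
    {s t t' : CodingState F J κ} (h : Child k γ β s t) (h' : Child k γ β s t') (hne : t ≠ t')
    {ω ω' : ℕ → Fin m} (hω : ω ∈ t.cylinder) (hω' : ω' ∈ t'.cylinder) :
    ∃ i < level s.comp + k s.comp, ω i ≠ ω' i := by
  by_contra! hall
  rw [← seqPrefix_eq_iff] at hall
  obtain ⟨w, hw, h1⟩ := hω
  obtain ⟨w', hw', h2⟩ := hω'
  rw [level_child h, h.2] at h1
  rw [level_child h', h'.2] at h2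
  have := enc_inj hrec s (h.1 hw) (h'.1 hw') (h1.trans (hall.trans h2.symm))
  subst this
  exact hne (child_ext h h' (SimpleGraph.ConnectedComponent.eq_of_common_vertex hw hw'))

theorem isPartitionTree_cylinder [Nonempty (Fin m)] (hJ : F.IsInvariantSet J)
    (hrec : ∀ T, IsRecoding T (k T) (γ T) (β T)) (hk : ∀ T, 1 ≤ k T) (hκ : ∀ T, k T ≤ κ)
    {s₀ : CodingState F J κ} (hs₀ : s₀.comp = (F.horizontal J).connectedComponentMk [])
    (hs₀e : s₀.enc = id) :
    IsPartitionTree s₀ (Child k γ β) (cylinder (F := F) (J := J) (κ := κ)) where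
  root := by
    refine Set.eq_univ_of_forall fun ω => ?_
    have hnil : ([] : List (Fin m)) ∈ s₀.comp.supp := by rw [hs₀]; rfl
    have hl := length_of_mem hnil
    refine ⟨[], hnil, ?_⟩
    rw [hs₀e, ← hl]
    rfl
  existsUnique s ω hω := by
    obtain ⟨u, hu, hω⟩ := hω
    -- The prefix of `ω` at the level of `s` names the group `u`; the next `k` letters pick one word
    -- in that group, and its component is the child sought.
    obtain ⟨w, hw, hwu, hwv⟩ := (hrec s.comp).exists_eq hu
      (length_seqPrefix (fun j => ω (level s.comp + j)) (k s.comp))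
    have hwZ : w ∈ ((F.horizontal J).connectedComponentMk w).supp := rfl
    obtain ⟨t, ht, htZ⟩ := exists_child hrec hκ s (hJ.supp_subset_descendants hwZ hw)
    refine ⟨t, ⟨ht, w, by rw [htZ]; exact hwZ, ?_⟩, ?_⟩
    · rw [level_child ht, ht.2, seqPrefix_add, ← hω]
      simp only [hwu, hwv]
    · rintro t' ⟨ht', w', hw', h2⟩
      rw [level_child ht', ht'.2, seqPrefix_add, ← hω, ← hwu, ← hwv] at h2
      obtain rfl := enc_inj hrec s (ht'.1 hw') hw h2
      exact child_ext ht' ht (SimpleGraph.ConnectedComponent.eq_of_common_vertex hw'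
        (by rw [htZ]; exact hwZ))
  subset s t h := by
    rintro ω ⟨w, hw, h1⟩
    have hm := (hrec s.comp).mem w (h.1 hw)
    rw [level_child h, h.2, seqPrefix_add] at h1
    exact ⟨_, hm, (List.append_inj h1 (by rw [s.length_enc _ hm, length_seqPrefix])).1⟩
  nonempty s := by
    obtain ⟨u, hu⟩ := s.comp.nonempty_supp
    obtain ⟨ω, hω⟩ := exists_seqPrefix_eq (s.enc u)
    rw [s.length_enc u hu] at hω
    exact ⟨ω, u, hu, hω.symm⟩
  isClosed s := isClosed_setOf_seqPrefix_mem _ _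
  subsingleton a _ ha ω hω ω' hω' := by
    funext i
    have hi := le_level hk ha (i + κ + 1)
    exact agree_of_mem_cylinder (Set.mem_iInter.1 hω (i + κ + 1))
      (Set.mem_iInter.1 hω' (i + κ + 1)) i (by omega)

theorem isPartitionTree_pieceOf (hr0 : 0 < r) (hr1 : r < 1) (hK : F.IsSelfSimilarSet K)
    (hJ : F.IsInvariantSet J) {B : ℕ} (hB : ∀ T : F.Component J, T.supp.ncard ≤ B)
    (hrec : ∀ T, IsRecoding T (k T) (γ T) (β T)) (hk : ∀ T, 1 ≤ k T) (hκ : ∀ T, k T ≤ κ)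
    {s₀ : CodingState F J κ} (hs₀ : s₀.comp = (F.horizontal J).connectedComponentMk []) :
    IsPartitionTree s₀ (Child k γ β) (pieceOf (F := F) (J := J) (κ := κ) K) where
  root := by
    refine Set.eq_univ_of_forall fun x => mem_piece.2 ⟨[], by rw [hs₀]; rfl, x, x.2, rfl⟩
  existsUnique s x hx := by
    obtain ⟨Z, hZ, hxZ⟩ := hJ.exists_component hK hx (k s.comp)
    obtain ⟨t, ht, rfl⟩ := exists_child hrec hκ s hZ
    refine ⟨t, ⟨ht, hxZ⟩, ?_⟩
    rintro t' ⟨ht', hx'⟩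
    exact child_ext ht' ht (eq_of_mem_piece (hK.subset_isInvariantSet hr0 hr1 hJ)
      ((level_child ht').trans (level_child ht).symm) hx' hxZ)
  subset s t h := by
    intro x hx
    obtain ⟨w, hw, hxw⟩ := mem_piece.1 hx
    exact mem_piece.2 ⟨_, (h.1 hw).2, hK.isInvariantSet.cell_subset_take _ _ hxw⟩
  nonempty s := by
    obtain ⟨u, hu⟩ := s.comp.nonempty_supp
    obtain ⟨x, hx⟩ := hK.nonempty
    exact ⟨⟨F.wordMap u x, hK.isInvariantSet.cell_subset u ⟨x, hx, rfl⟩⟩,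
      mem_piece.2 ⟨u, hu, x, hx, rfl⟩⟩
  isClosed s := (isCompact_piece hK.isCompact s.comp).isClosed.preimage continuous_subtype_val
  subsingleton a _ ha x hx y hy := by
    obtain ⟨M, hM0, hM⟩ := hJ.exists_dist_le
    have hle : ∀ j : ℕ, dist x y ≤ B * M * r ^ j := by
      intro j
      refine (dist_le_of_mem_piece hr0.le hM0.le hM (hK.subset_isInvariantSet hr0 hr1 hJ) (hB _)
        (Set.mem_iInter.1 hx j) (Set.mem_iInter.1 hy j)).trans ?_
      exact mul_le_mul_of_nonneg_left (pow_le_pow_of_le_one hr0.le hr1.le (le_level hk ha j))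
        (by positivity)
    have hlim := (tendsto_pow_atTop_nhds_zero_of_lt_one hr0.le hr1).const_mul (B * M)
    rw [mul_zero] at hlim
    exact dist_le_zero.1 (ge_of_tendsto' hlim hle)

end

end CodingState

open CodingState in
/-- If the descendants of each component, at some bounded depth, can be grouped according to the
words of the component, then `K` is coded by the sequences of letters. -/
theorem IsSelfSimilarSet.isCoded_of_hasGrouping (hr0 : 0 < r) (hr1 : r < 1)
    (hK : F.IsSelfSimilarSet K) (hH : F.ConditionH K) (hJ : F.IsInvariantSet J) {B κ : ℕ}
    (hB : ∀ T : F.Component J, T.supp.ncard ≤ B)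
    (hG : ∀ T : F.Component J, ∃ k, 1 ≤ k ∧ k ≤ κ ∧ HasGrouping T k) :
    IsCoded K (Fin m) r := by
  have hne : Nonempty (Fin m) := by
    obtain ⟨x, hx⟩ := hK.nonempty
    rw [hK.eq_iUnion] at hx
    exact ⟨(Set.mem_iUnion.1 hx).choose⟩
  choose k hk hκ hG using hG
  choose γ β hrec using fun T => (hG T).exists_isRecoding
  have hroot : ∀ u ∈ ((F.horizontal J).connectedComponentMk []).supp, u = [] := fun u hu => by
    have := length_of_mem hu
    have h0 := length_of_mem (show [] ∈ ((F.horizontal J).connectedComponentMk []).supp from rfl)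
    exact List.length_eq_zero_iff.1 (this.trans h0.symm)
  let s₀ : CodingState F J κ := ⟨(F.horizontal J).connectedComponentMk [], id, Set.injOn_id _,
    fun u hu => length_of_mem hu, fun u hu v hv => by rw [hroot u hu, hroot v hv]⟩
  have hKJ := hK.subset_isInvariantSet hr0 hr1 hJ
  have : CompactSpace K := isCompact_iff_compactSpace.1 hK.isCompact
  have hP := isPartitionTree_pieceOf hr0 hr1 hK hJ hB hrec hk hκ (s₀ := s₀) rfl
  have hQ := isPartitionTree_cylinder hJ hrec hk hκ (s₀ := s₀) rfl rfl
  obtain ⟨f, hf⟩ := hP.exists_equiv hQ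
  obtain ⟨M, hM0, hM⟩ := hJ.exists_dist_le
  obtain ⟨c, hc0, hc⟩ := hH
  -- Distinct points split at a state `s`. Their codes agree before index `level s - κ` and differ
  -- before `level s + κ`, which costs `r ^ κ` in the upper bound. The separation comes from the
  -- children, up to `κ` levels further down, hence `r ^ (2 * κ)` in the lower bound. The `+ 1`
  -- ensures positivity.
  refine ⟨f, c * r ^ (2 * κ), (B * M + 1) / r ^ κ, by positivity, by positivity, fun n x y =>
    ⟨fun h => ?_, ?_⟩⟩
  · by_cases hxy : x = y
    · rw [hxy, dist_self]; positivity
    obtain ⟨s, t, t', ht, ht', htt, hx, hy, hfx, hfy⟩ := hf x y hxy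
    obtain ⟨i, hi, hne⟩ := disagree_of_mem_cylinder hrec ht ht' htt hfx hfy
    have hni : n ≤ level s.comp + κ := by
      by_contra! hlt
      have := hκ s.comp
      exact hne (h i (by omega))
    have h1 : dist (x : EuclideanSpace ℝ (Fin d)) y ≤ B * M * r ^ level s.comp :=
      dist_le_of_mem_piece hr0.le hM0.le hM hKJ (hB _) (hP.subset _ _ ht hx)
        (hP.subset _ _ ht' hy)
    refine h1.trans ?_
    calc (B * M) * r ^ level s.comp ≤ (B * M + 1) * r ^ level s.comp := by gcongr; linarith
      _ = (B * M + 1) / r ^ κ * r ^ (level s.comp + κ) := by rw [pow_add]; field_simp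
      _ ≤ _ := mul_le_mul_of_nonneg_left (pow_le_pow_of_le_one hr0.le hr1.le hni) (by positivity)
  · rintro ⟨i, hi, hne⟩
    obtain ⟨s, t, t', ht, ht', htt, hx, hy, hfx, hfy⟩ :=
      hf x y (fun he => hne (by rw [he]))
    have hni : level s.comp ≤ n + κ := by
      by_contra! hlt
      exact hne (agree_of_mem_cylinder (hQ.subset _ _ ht hfx) (hQ.subset _ _ ht' hfy) i (by omega))
    have hlt := level_child ht
    have hlt' := level_child ht'
    have hk1 := hk s.comp
    have hk2 := hκ s.comp
    have h1 : c * r ^ level t.comp ≤ dist (x : EuclideanSpace ℝ (Fin d)) y :=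
      le_dist_of_mem_piece hKJ hc (fun he => htt (child_ext ht ht' he)) (hlt.trans hlt'.symm)
        (by omega) hx hy
    refine le_trans ?_ h1
    rw [mul_assoc, ← pow_add]
    exact mul_le_mul_of_nonneg_left (pow_le_pow_of_le_one hr0.le hr1.le (by omega)) hc0.le

end EqualRatioIFS

/-! ### Distributing sized objects into equal groups -/

section Assignments

variable {α : Type*} [DecidableEq α]

theorem exists_card_fiber_eq {p : ℕ} (hp : 0 < p) (s : Finset α) (c : Fin p → ℕ)
    (hs : s.card = ∑ g, c g) :
    ∃ h : α → Fin p, ∀ g, (s.filter fun x => h x = g).card = c g := by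
  let e : s ≃ Σ g, Fin (c g) := Fintype.equivOfCardEq (by simp [hs])
  refine ⟨fun x => if hx : x ∈ s then (e ⟨x, hx⟩).1 else ⟨0, hp⟩, fun g => ?_⟩
  have himg : (s.filter fun x => (if hx : x ∈ s then (e ⟨x, hx⟩).1 else ⟨0, hp⟩) = g) =
      Finset.univ.image fun i : Fin (c g) => (e.symm ⟨g, i⟩ : α) := by
    ext x
    simp only [Finset.mem_filter, Finset.mem_image, Finset.mem_univ, true_and]
    constructor
    · rintro ⟨hx, h⟩
      rw [dif_pos hx] at h
      subst h
      exact ⟨(e ⟨x, hx⟩).2, by simp⟩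
    · rintro ⟨i, rfl⟩
      simp
  rw [himg, Finset.card_image_of_injective, Finset.card_univ, Fintype.card_fin]
  intro i j hij
  have := e.symm.injective (Subtype.ext hij)
  simpa using this

/-- A rearrangement of a row vector distributes the objects it counts into groups of size `N`. -/
theorem exists_assignment_of_rearrangement {p q N : ℕ} (hp : 0 < p) (s : Finset α) (sz : α → ℕ)
    (cl : α → Fin q) (b : Fin q → ℕ) (hsz : ∀ x ∈ s, sz x = b (cl x))
    (C : Matrix (Fin p) (Fin q) ℕ) (hs : ∀ j, (s.filter fun x => cl x = j).card = ∑ g, C g j)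
    (hC : ∀ g, ∑ j, C g j * b j = N) :
    ∃ gr : α → Fin p, ∀ g, ∑ x ∈ s with gr x = g, sz x = N := by
  choose h hh using fun j => exists_card_fiber_eq hp (s.filter fun x => cl x = j) (fun g => C g j)
    (hs j)
  refine ⟨fun x => h (cl x) x, fun g => ?_⟩
  rw [← hC g, ← Finset.sum_fiberwise (s.filter fun x => h (cl x) x = g) cl sz]
  refine Finset.sum_congr rfl fun j _ => ?_
  have hset : ((s.filter fun x => h (cl x) x = g).filter fun x => cl x = j) =
      (s.filter fun x => cl x = j).filter fun x => h j x = g := by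
    ext x
    simp only [Finset.mem_filter]
    constructor
    · rintro ⟨⟨h1, h2⟩, rfl⟩; exact ⟨⟨h1, rfl⟩, h2⟩
    · rintro ⟨⟨h1, rfl⟩, h2⟩; exact ⟨⟨h1, h2⟩, rfl⟩
  rw [hset, ← hh j g, ← smul_eq_mul]
  refine Finset.sum_eq_card_nsmul fun x hx => ?_
  simp only [Finset.mem_filter] at hx
  rw [hsz x hx.1.1, hx.1.2]

/-- Pigeonhole: if no group had room for `x`, every load would be at least `N - (sz x - 1)`, and the
total would be too large. -/
theorem exists_assignment_insert {p N : ℕ} {t : Finset α} {x : α} (hx : x ∉ t) (sz : α → ℕ)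
    (ht : ∃ gr : α → Fin p, ∀ g, ∑ y ∈ t with gr y = g, sz y ≤ N)
    (hlt : ∑ y ∈ t, sz y + p * (sz x - 1) < p * N) :
    ∃ gr : α → Fin p, ∀ g, ∑ y ∈ insert x t with gr y = g, sz y ≤ N := by
  obtain ⟨gr, hgr⟩ := ht
  obtain ⟨g₀, hg₀⟩ : ∃ g₀, ∑ y ∈ t with gr y = g₀, sz y + (sz x - 1) < N := by
    by_contra! hall
    have h1 := Finset.sum_le_sum fun g (_ : g ∈ (Finset.univ : Finset (Fin p))) => hall g
    rw [Finset.sum_add_distrib, Finset.sum_fiberwise] at h1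
    simp only [Finset.sum_const, Finset.card_univ, Fintype.card_fin, smul_eq_mul] at h1
    omega
  refine ⟨Function.update gr x g₀, fun g => ?_⟩
  have hsame : (t.filter fun y => Function.update gr x g₀ y = g) = t.filter fun y => gr y = g := by
    refine Finset.filter_congr fun y hy => ?_
    rw [Function.update_of_ne (ne_of_mem_of_not_mem hy hx)]
  rw [Finset.filter_insert, hsame]
  split_ifs with h
  · rw [Function.update_self] at h
    subst h
    rw [Finset.sum_insert (fun h => hx (Finset.mem_of_mem_filter _ h))]
    omega
  · exact hgr g

/-- Objects of sizes at most `B`, of total size `p N` and with many objects of size one, can be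
distributed into `p` groups of size `N`. -/
theorem exists_assignment_of_many_ones {p N B : ℕ} (hp : 0 < p) (s : Finset α) (sz : α → ℕ)
    (hpos : ∀ x ∈ s, 1 ≤ sz x) (hB : ∀ x ∈ s, sz x ≤ B) (hsum : ∑ x ∈ s, sz x = p * N)
    (hones : p * B ≤ (s.filter fun x => sz x = 1).card) :
    ∃ gr : α → Fin p, ∀ g, ∑ x ∈ s with gr x = g, sz x = N := by
  have hsplit := Finset.sum_filter_add_sum_filter_not s (fun x => sz x = 1) sz
  have hone : ∑ x ∈ s with sz x = 1, sz x = (s.filter fun x => sz x = 1).card := by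
    rw [Finset.card_eq_sum_ones]
    exact Finset.sum_congr rfl fun x hx => (Finset.mem_filter.1 hx).2
  have h1 : ∀ t : Finset α, t ⊆ s.filter (fun x => ¬sz x = 1) →
      ∃ gr : α → Fin p, ∀ g, ∑ y ∈ t with gr y = g, sz y ≤ N := by
    intro t
    induction t using Finset.induction_on with
    | empty => exact fun _ => ⟨fun _ => ⟨0, hp⟩, fun g => by simp⟩
    | insert x t hx ih =>
      intro ht
      refine exists_assignment_insert hx sz (ih ((Finset.subset_insert _ _).trans ht)) ?_
      have hxs := (Finset.mem_filter.1 (ht (Finset.mem_insert_self x t))).1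
      have h2 := Finset.sum_le_sum_of_subset (f := sz) ht
      rw [Finset.sum_insert hx] at h2
      -- The objects of size one, still unplaced, reserve at least `p * B` units, which bounds the
      -- space that can be wasted in the `p` groups.
      have h3 : p * (sz x - 1) ≤ p * B :=
        Nat.mul_le_mul_left p ((Nat.sub_le _ _).trans (hB x hxs))
      have := hpos x hxs
      omega
  have h2 : ∀ t : Finset α, t ⊆ s.filter (fun x => sz x = 1) →
      ∃ gr : α → Fin p, ∀ g, ∑ y ∈ t ∪ s.filter (fun x => ¬sz x = 1) with gr y = g, sz y ≤ N := by
    intro t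
    induction t using Finset.induction_on with
    | empty => intro _; simpa using h1 _ (Finset.Subset.refl _)
    | insert x t hx ih =>
      intro ht
      have hx1 := Finset.mem_filter.1 (ht (Finset.mem_insert_self x t))
      have hxt : x ∉ t ∪ s.filter (fun x => ¬sz x = 1) := by
        simp [hx, hx1.2]
      rw [Finset.insert_union]
      refine exists_assignment_insert hxt sz (ih ((Finset.subset_insert _ _).trans ht)) ?_
      have h3 : insert x (t ∪ s.filter (fun x => ¬sz x = 1)) ⊆ s := by
        rw [← Finset.insert_union]
        exact Finset.union_subset (ht.trans (Finset.filter_subset _ _)) (Finset.filter_subset _ _)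
      have h4 := Finset.sum_le_sum_of_subset (f := sz) h3
      rw [Finset.sum_insert hxt, hx1.2, hsum] at h4
      rw [hx1.2]
      simp only [Nat.sub_self, mul_zero]
      omega
  obtain ⟨gr, hgr⟩ := h2 _ (Finset.Subset.refl _)
  rw [Finset.filter_union_filter_not_eq] at hgr
  refine ⟨gr, fun g => ?_⟩
  -- No load exceeds `N` and the loads add up to `p * N`, so all are equal to `N`.
  refine (Finset.sum_eq_sum_iff_of_le (fun g (_ : g ∈ Finset.univ) => hgr g)).1 ?_ g
    (Finset.mem_univ g)
  rw [Finset.sum_fiberwise, hsum]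
  simp

end Assignments

/-! ### Groupings from assignments of components -/

namespace EqualRatioIFS

variable {d m : ℕ} {r : ℝ} {F : EqualRatioIFS d m r} {J K : Set (EuclideanSpace ℝ (Fin d))}

section Grouping

open Classical in
/-- The components consisting of descendants of `T` of depth `k`. -/
noncomputable def subcomponents (T : F.Component J) (k : ℕ) : Finset (F.Component J) :=
  (finite_descendants T k).toFinset.image (F.horizontal J).connectedComponentMk

theorem IsInvariantSet.mem_subcomponents (hJ : F.IsInvariantSet J) {T Z : F.Component J} {k : ℕ} :
    Z ∈ subcomponents T k ↔ Z.supp ⊆ descendants T k := by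
  classical
  simp only [subcomponents, Finset.mem_image, Set.Finite.mem_toFinset]
  constructor
  · rintro ⟨w, hw, rfl⟩
    exact hJ.supp_subset_descendants (Z := (F.horizontal J).connectedComponentMk w) rfl hw
  · intro h
    obtain ⟨w, hw⟩ := Z.nonempty_supp
    exact ⟨w, h hw, hw⟩

theorem sum_ncard_supp (Z : Finset (F.Component J)) :
    ∑ T ∈ Z, T.supp.ncard = {w | (F.horizontal J).connectedComponentMk w ∈ Z}.ncard := by
  classical
  suffices h : {w | (F.horizontal J).connectedComponentMk w ∈ Z}.Finite ∧
      ∑ T ∈ Z, T.supp.ncard = {w | (F.horizontal J).connectedComponentMk w ∈ Z}.ncard from h.2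
  induction Z using Finset.induction_on with
  | empty => simp
  | insert T Z hT ih =>
    have hset : {w | (F.horizontal J).connectedComponentMk w ∈ insert T Z} =
        T.supp ∪ {w | (F.horizontal J).connectedComponentMk w ∈ Z} := by
      ext w
      simp
    rw [hset]
    refine ⟨(finite_supp T).union ih.1, ?_⟩
    rw [Set.ncard_union_eq _ (finite_supp T) ih.1, Finset.sum_insert hT, ih.2]
    refine Set.disjoint_left.2 fun w hw hw' => hT ?_
    rw [SimpleGraph.ConnectedComponent.mem_supp_iff] at hw
    exact hw ▸ hw'

theorem IsInvariantSet.sum_subcomponents (hJ : F.IsInvariantSet J) (T : F.Component J) (k : ℕ) :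
    ∑ Z ∈ subcomponents T k, Z.supp.ncard = T.supp.ncard * m ^ k := by
  rw [sum_ncard_supp, ← ncard_descendants]
  congr 1
  ext w
  rw [Set.mem_ofPred_eq, hJ.mem_subcomponents]
  exact ⟨fun h => h rfl,
    fun h => hJ.supp_subset_descendants (Z := (F.horizontal J).connectedComponentMk w) rfl h⟩

-- Comparing total sizes forces `p = #T`, so the groups can be labelled by the words of `T`.
open Classical in
theorem IsInvariantSet.hasGrouping_of_assignment (hJ : F.IsInvariantSet J) (hm : 0 < m)
    {T : F.Component J} {k p : ℕ} (gr : F.Component J → Fin p)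
    (h : ∀ g, ∑ Z ∈ subcomponents T k with gr Z = g, Z.supp.ncard = m ^ k) :
    HasGrouping T k := by
  have hp : T.supp.ncard = p := by
    have h1 := hJ.sum_subcomponents T k
    rw [← Finset.sum_fiberwise _ gr, Finset.sum_congr rfl fun g _ => h g] at h1
    simp only [Finset.sum_const, Finset.card_univ, Fintype.card_fin, smul_eq_mul] at h1
    exact (Nat.eq_of_mul_eq_mul_right (by positivity) h1).symm
  have : Finite T.supp := finite_supp T
  let e : T.supp ≃ Fin p := Finite.equivFinOfCardEq hp
  refine ⟨fun w => e.symm (gr ((F.horizontal J).connectedComponentMk w)),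
    fun w _ => Subtype.coe_prop _,
    fun w _ w' hw => by beta_reduce; rw [SimpleGraph.ConnectedComponent.sound hw],
    fun u hu => ?_⟩
  rw [← h (e ⟨u, hu⟩), sum_ncard_supp]
  congr 1
  ext w
  simp only [Set.mem_ofPred_eq, Finset.mem_filter, hJ.mem_subcomponents]
  refine and_congr ⟨fun h => hJ.supp_subset_descendants
    (Z := (F.horizontal J).connectedComponentMk w) rfl h, fun h => h rfl⟩ ?_
  rw [← e.symm_apply_eq, Subtype.ext_iff]

theorem hasGrouping_of_subsingleton (hm : m = 1) (T : F.Component J) : HasGrouping T 1 := by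
  subst hm
  have hss : ∀ w w' : List (Fin 1), w.length = w'.length → w = w' := fun w w' h =>
    List.ext_getElem h fun _ _ _ => Subsingleton.elim _ _
  refine ⟨fun w => w.take (level T), fun w hw => hw.2, fun w _ w' hw => ?_, fun u hu => ?_⟩
  · rw [hss w w' (length_eq_of_reachable hw)]
  · rw [one_pow, Set.ncard_eq_one]
    refine ⟨u ++ [0], Set.eq_singleton_iff_unique_mem.2 ⟨⟨append_mem_descendants hu, ?_⟩, ?_⟩⟩
    · beta_reduce
      rw [← length_of_mem hu, List.take_left]
    · rintro w ⟨hw, -⟩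
      refine hss _ _ ?_
      rw [hw.1, ← length_of_mem hu]
      simp

theorem ncard_supp_le_one (hm : m = 1) (T : F.Component J) : T.supp.ncard ≤ 1 := by
  subst hm
  refine (Set.ncard_le_one (finite_supp T)).2 fun u hu v hv =>
    List.ext_getElem ((length_of_mem hu).trans (length_of_mem hv).symm) fun _ _ _ =>
      Subsingleton.elim _ _

end Grouping

end EqualRatioIFS

/-! ### Sizes of equivalent components -/

namespace EqualRatioIFS

variable {d m : ℕ} {r : ℝ} {F : EqualRatioIFS d m r} {J K : Set (EuclideanSpace ℝ (Fin d))}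

section Sizes

theorem length_of_mem_family {T : F.Component J} {w : List (Fin m)} (h : w ∈ family T) :
    w ∈ T.supp ∨ w ∉ T.supp ∧ w.length = level T + 1 := by
  rcases h with h | h
  · exact Or.inl h
  · rw [offspring_eq] at h
    refine Or.inr ⟨fun hw => ?_, h.1⟩
    have := length_of_mem hw
    have := h.1
    omega

/-- In the family of `T`, the words of `T` are the vertices with two vertical neighbours. -/
theorem mem_supp_iff_exists_vertical (hm : 2 ≤ m) {T : F.Component J} (x : family T) :
    (x : List (Fin m)) ∈ T.supp ↔ ∃ y z : family T, y ≠ z ∧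
      (vertical m).Adj (y : List (Fin m)) x ∧ (vertical m).Adj (z : List (Fin m)) x := by
  constructor
  · intro hx
    have hmem : ∀ i, (x : List (Fin m)) ++ [i] ∈ family T := fun i => Or.inr ⟨x, hx, i, rfl⟩
    refine ⟨⟨_, hmem ⟨0, by omega⟩⟩, ⟨_, hmem ⟨1, by omega⟩⟩, ?_, Or.inr ⟨_, rfl⟩, Or.inr ⟨_, rfl⟩⟩
    simp
  · rintro ⟨y, z, hne, hy, hz⟩
    rcases length_of_mem_family x.2 with hx | ⟨-, hx⟩
    · exact hx
    exfalso
    have key : ∀ y : family T, (vertical m).Adj (y : List (Fin m)) x →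
        (y : List (Fin m)) = (x : List (Fin m)).dropLast := by
      rintro y (⟨i, hi⟩ | ⟨i, hi⟩)
      · rw [hi, List.dropLast_concat]
      · have h1 : (y : List (Fin m)).length = level T + 2 := by rw [hi]; simp [hx]
        rcases length_of_mem_family y.2 with h | ⟨-, h⟩
        · have := length_of_mem h; omega
        · omega
    exact hne (Subtype.ext ((key y hy).trans (key z hz).symm))

/-- Having two vertical neighbours is preserved by the bijection of families, so it maps `T` into
`T'`. -/
theorem Equivalent.ncard_le (hm : 2 ≤ m) {T T' : F.Component J} (h : Equivalent T T') :
    T.supp.ncard ≤ T'.supp.ncard := by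
  obtain ⟨g, hv, -⟩ := h
  have hg : ∀ x : family T, (x : List (Fin m)) ∈ T.supp → (g x : List (Fin m)) ∈ T'.supp := by
    intro x hx
    rw [mem_supp_iff_exists_vertical hm] at hx ⊢
    obtain ⟨y, z, hne, hy, hz⟩ := hx
    exact ⟨g y, g z, g.injective.ne hne, (hv _ _).2 hy, (hv _ _).2 hz⟩
  have : Finite T'.supp := finite_supp T'
  let φ : T.supp → T'.supp := fun u => ⟨g ⟨u, Or.inl u.2⟩, hg _ u.2⟩
  refine Nat.card_le_card_of_injective φ fun u v huv => ?_
  have h1 : (g ⟨u, Or.inl u.2⟩ : List (Fin m)) = g ⟨v, Or.inl v.2⟩ := by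
    have h := congrArg Subtype.val huv
    exact h
  have h2 := congrArg Subtype.val (g.injective (Subtype.ext h1))
  exact Subtype.ext h2

theorem ncard_supp_eq_of_connectedClass_eq (hm : 2 ≤ m) {T T' : F.Component J}
    (h : connectedClass T = connectedClass T') : T.supp.ncard = T'.supp.ncard := by
  have h1 : Equivalent T T' := Quotient.exact h
  have h2 : Equivalent T' T := Quotient.exact h.symm
  exact le_antisymm (h1.ncard_le hm) (h2.ncard_le hm)

theorem IsSimple.exists_ncard_le (hm : 2 ≤ m) (hS : F.IsSimple J) :
    ∃ B, ∀ T : F.Component J, T.supp.ncard ≤ B := by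
  have : Finite (Quotient (F.componentSetoid J)) := hS
  obtain ⟨B, hB⟩ := Finite.exists_le fun c : Quotient (F.componentSetoid J) => c.out.supp.ncard
  refine ⟨B, fun T => ?_⟩
  rw [ncard_supp_eq_of_connectedClass_eq hm (T' := (connectedClass T).out)
    (Quotient.out_eq _).symm]
  exact hB _

/-- Each choice of representatives of the connected classes gives an incidence matrix. -/
theorem isIncidence_of_section {q : ℕ} (e : Quotient (F.componentSetoid J) ≃ Fin q)
    (sel : Quotient (F.componentSetoid J) → F.Component J)
    (hsel : ∀ c, connectedClass (sel c) = c) :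
    F.IsIncidence J
      (Matrix.of fun i j => {Z : F.Component J | Z.supp ⊆ offspring (sel (e.symm i)) ∧
        connectedClass Z = e.symm j}.ncard)
      (fun i => (sel (e.symm i)).supp.ncard) := by
  refine ⟨fun i => sel (e.symm i), ?_, fun i j => ?_, fun i => rfl⟩
  · simp only [hsel]
    exact e.symm.bijective
  · simp only [hsel, Matrix.of_apply]

end Sizes

/-! ### Rearrangeable incidence matrices -/

section Rearrangeable

theorem hasGrouping_of_rearrangeable (hm : 2 ≤ m) (hJ : F.IsInvariantSet J) (hS : F.IsSimple J)
    (hA : F.HasRearrangeableIncidence J) (T : F.Component J) : HasGrouping T 1 := by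
  classical
  have : Finite (Quotient (F.componentSetoid J)) := hS
  obtain ⟨q, ⟨e⟩⟩ := Finite.exists_equiv_fin (Quotient (F.componentSetoid J))
  -- `T` itself represents its class, so that its row counts the offspring components of `T`. Those
  -- of another representative may belong to other classes.
  let sel : Quotient (F.componentSetoid J) → F.Component J :=
    fun c => if c = connectedClass T then T else c.out
  have hsel : ∀ c, connectedClass (sel c) = c := by
    intro c
    by_cases hc : c = connectedClass T
    · simp [sel, hc]
    · simp only [sel, hc, if_false]
      exact Quotient.out_eq c
  obtain ⟨p, hp, C, hC, hCb⟩ := hA q _ _ (isIncidence_of_section e sel hsel) (e (connectedClass T))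
  have hselT : sel (connectedClass T) = T := by simp [sel]
  have hcount : ∀ j, ((subcomponents T 1).filter fun Z => e (connectedClass Z) = j).card =
      ∑ g, C g j := by
    intro j
    have h1 := congrFun hC j
    simp only [Matrix.of_apply, Equiv.symm_apply_apply, hselT, offspring_eq, Matrix.vecMul,
      dotProduct, one_mul] at h1
    rw [← h1, ← Set.ncard_coe_finset]
    congr 1
    ext Z
    simp only [Finset.coe_filter, Set.mem_ofPred_eq, hJ.mem_subcomponents, Equiv.eq_symm_apply]
  obtain ⟨gr, hgr⟩ := exists_assignment_of_rearrangement hp (subcomponents T 1)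
    (fun Z => Z.supp.ncard) (fun Z => e (connectedClass Z))
    (fun j => (sel (e.symm j)).supp.ncard)
    (fun Z _ => ncard_supp_eq_of_connectedClass_eq hm (by rw [hsel, Equiv.symm_apply_apply]))
    C hcount (congrFun hCb)
  exact hJ.hasGrouping_of_assignment (by omega) gr (by simpa using hgr)

end Rearrangeable

/-! ### Primitive incidence matrices -/

section Primitive

/-- Let `W` be the set of classes whose members reach a singleton component within a uniform depth;
the root class is in `W`. If some class were outside, representatives could be chosen so that no
class outside `W` has an offspring component with class in `W`. The incidence matrix would then be
block triangular, as would all its powers, contradicting primitivity. -/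
theorem HasPrimitiveIncidence.exists_singleton (hm : 2 ≤ m) (hS : F.IsSimple J)
    (hA : F.HasPrimitiveIncidence J) :
    ∃ N, ∀ T : F.Component J, ∃ j ≤ N, ∃ Z : F.Component J,
      Z.supp ⊆ descendants T j ∧ Z.supp.ncard = 1 := by
  classical
  have : Finite (Quotient (F.componentSetoid J)) := hS
  let Good : ℕ → F.Component J → Prop := fun N T =>
    ∃ j ≤ N, ∃ Z : F.Component J, Z.supp ⊆ descendants T j ∧ Z.supp.ncard = 1
  have hmono : ∀ {N N' T}, N ≤ N' → Good N T → Good N' T :=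
    fun h ⟨j, hj, hZ⟩ => ⟨j, hj.trans h, hZ⟩
  let W : Set (Quotient (F.componentSetoid J)) :=
    {c | ∃ N, ∀ T, connectedClass T = c → Good N T}
  have hN : ∀ c, ∃ N, c ∈ W → ∀ T, connectedClass T = c → Good N T := by
    intro c
    by_cases hc : c ∈ W
    · obtain ⟨N, hN⟩ := hc
      exact ⟨N, fun _ => hN⟩
    · exact ⟨0, fun h => absurd h hc⟩
  choose n hn using hN
  obtain ⟨N, hN⟩ := Finite.exists_le n
  have hW : ∀ T : F.Component J, connectedClass T ∈ W → Good N T :=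
    fun T hT => hmono (hN _) (hn _ hT T rfl)
  by_cases hall : ∀ c, c ∈ W
  · exact ⟨N, fun T => hW T (hall _)⟩
  exfalso
  push Not at hall
  obtain ⟨c₀, hc₀⟩ := hall
  let ρ : F.Component J := (F.horizontal J).connectedComponentMk []
  have hρ : connectedClass ρ ∈ W := by
    refine ⟨0, fun T hT => ⟨0, le_rfl, T, by rw [descendants_zero], ?_⟩⟩
    rw [ncard_supp_eq_of_connectedClass_eq hm hT, Set.ncard_eq_one]
    refine ⟨[], Set.eq_singleton_iff_unique_mem.2 ⟨rfl, fun u hu => ?_⟩⟩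
    have h0 := length_of_mem (show [] ∈ ρ.supp from rfl)
    exact List.length_eq_zero_iff.1 ((length_of_mem hu).trans h0.symm)
  have hsel : ∀ c : Quotient (F.componentSetoid J), ∃ T : F.Component J, connectedClass T = c ∧
      (c ∉ W → ∀ Z : F.Component J, Z.supp ⊆ descendants T 1 → connectedClass Z ∉ W) := by
    intro c
    by_cases hc : c ∈ W
    · exact ⟨c.out, Quotient.out_eq c, fun h => absurd hc h⟩
    · have h1 : ∃ T, connectedClass T = c ∧ ¬ Good (N + 1) T := by
        by_contra! h
        exact hc ⟨N + 1, h⟩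
      obtain ⟨T, hT, hbad⟩ := h1
      refine ⟨T, hT, fun _ Z hZ hZW => hbad ?_⟩
      obtain ⟨j, hj, Y, hY, hY1⟩ := hW Z hZW
      exact ⟨1 + j, by omega, Y, hY.trans (descendants_subset_of_subset hZ), hY1⟩
  choose sel hsel hsel' using hsel
  obtain ⟨q, ⟨e⟩⟩ := Finite.exists_equiv_fin (Quotient (F.componentSetoid J))
  have hprim := hA q _ _ (isIncidence_of_section e sel hsel)
  obtain ⟨k, hk, hpos⟩ := hprim.exists_pos_pow
  set A := (Matrix.of fun i j => {Z : F.Component J | Z.supp ⊆ offspring (sel (e.symm i)) ∧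
        connectedClass Z = e.symm j}.ncard).map (Nat.cast : ℕ → ℤ) with hAdef
  have hzero : ∀ i j, e.symm i ∉ W → e.symm j ∈ W → A i j = 0 := by
    intro i j hi hj
    simp only [hAdef, Matrix.map_apply, Matrix.of_apply, Nat.cast_eq_zero]
    have : {Z : F.Component J | Z.supp ⊆ offspring (sel (e.symm i)) ∧
        connectedClass Z = e.symm j} = ∅ := by
      refine Set.eq_empty_of_forall_notMem ?_
      rintro Z ⟨hZ, hZj⟩
      rw [offspring_eq] at hZ
      exact hsel' _ hi Z hZ (hZj ▸ hj)
    rw [this, Set.ncard_empty]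
  have hpow : ∀ k i j, e.symm i ∉ W → e.symm j ∈ W → (A ^ k) i j = 0 := by
    intro k
    induction k with
    | zero =>
      intro i j hi hj
      rw [pow_zero, Matrix.one_apply_ne]
      rintro rfl
      exact hi hj
    | succ k ih =>
      intro i j hi hj
      rw [pow_succ, Matrix.mul_apply]
      refine Finset.sum_eq_zero fun l _ => ?_
      by_cases hl : e.symm l ∈ W
      · rw [ih i l hi hl, zero_mul]
      · rw [hzero l j hl hj, mul_zero]
  have h1 := hpos (e c₀) (e (connectedClass ρ))
  rw [hpow k _ _ (by simpa using hc₀) (by simpa using hρ)] at h1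
  exact lt_irrefl _ h1

theorem exists_hasGrouping_of_primitive (hm : 2 ≤ m) (hJ : F.IsInvariantSet J) (hS : F.IsSimple J)
    (hA : F.HasPrimitiveIncidence J) :
    ∃ κ, ∀ T : F.Component J, ∃ k, 1 ≤ k ∧ k ≤ κ ∧ HasGrouping T k := by
  classical
  obtain ⟨B, hB⟩ := hS.exists_ncard_le hm
  obtain ⟨N, hN⟩ := hA.exists_singleton hm hS
  choose δ hδ Y hY hY1 using hN
  -- At depth `l + 1` the total size exceeds `l`, so with sizes at most `B` there are at least `(N +
  -- 1) * B ^ 2` components. Among the `N + 1` possible values of `δ`, one is then shared by `B ^ 2`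
  -- of them.
  set l := (N + 1) * (B * B) * B
  refine ⟨l + 1 + N, fun T => ?_⟩
  have hB1 : 0 < B := (ncard_supp_pos T).trans_le (hB T)
  have hcard : (N + 1) * (B * B) ≤ (subcomponents T (l + 1)).card := by
    have h1 := hJ.sum_subcomponents T (l + 1)
    have h2 : ∑ Z ∈ subcomponents T (l + 1), Z.supp.ncard ≤ (subcomponents T (l + 1)).card * B :=
      Finset.sum_le_card_nsmul _ _ _ fun Z _ => hB Z
    have h3 : l + 1 < m ^ (l + 1) := Nat.lt_pow_self (by omega)
    have h4 : m ^ (l + 1) ≤ T.supp.ncard * m ^ (l + 1) :=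
      Nat.le_mul_of_pos_left _ (ncard_supp_pos T)
    refine Nat.le_of_mul_le_mul_right (c := B) ?_ hB1
    change l ≤ _
    omega
  obtain ⟨j, hj, hjc⟩ := Finset.exists_le_card_fiber_of_mul_le_card_of_maps_to
    (s := subcomponents T (l + 1)) (t := Finset.range (N + 1)) (f := δ) (n := B * B)
    (fun Z _ => Finset.mem_range.2 (Nat.lt_succ_of_le (hδ Z))) (by simp) (by simpa using hcard)
  have hjN : j ≤ N := Nat.lt_succ_iff.1 (Finset.mem_range.1 hj)
  refine ⟨l + 1 + j, by omega, by omega, ?_⟩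
  have hones : B * B ≤ ((subcomponents T (l + 1 + j)).filter fun Z => Z.supp.ncard = 1).card := by
    refine hjc.trans (Finset.card_le_card_of_injOn Y (fun Z hZ => ?_) fun Z hZ Z' hZ' he => ?_)
    · simp only [Finset.coe_filter, Set.mem_ofPred_eq, hJ.mem_subcomponents] at hZ ⊢
      obtain ⟨hZ, rfl⟩ := hZ
      exact ⟨(hY Z).trans (descendants_subset_of_subset hZ), hY1 Z⟩
    -- A word of the singleton component `Y Z` has its ancestor at the level of `Z` in `Z`, so `Y Z`
    -- determines `Z`.
    · simp only [Finset.coe_filter, Set.mem_ofPred_eq, hJ.mem_subcomponents] at hZ hZ'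
      obtain ⟨w, hw⟩ := (Y Z).nonempty_supp
      have h1 := (hY Z hw).2
      have h2 := (hY Z' (he ▸ hw)).2
      rw [level_of_subset hZ.1] at h1
      rw [level_of_subset hZ'.1] at h2
      exact SimpleGraph.ConnectedComponent.eq_of_common_vertex h1 h2
  obtain ⟨gr, hgr⟩ := exists_assignment_of_many_ones (ncard_supp_pos T)
    (subcomponents T (l + 1 + j)) (fun Z => Z.supp.ncard) (fun Z _ => ncard_supp_pos Z)
    (fun Z _ => hB Z) (hJ.sum_subcomponents T _) ((Nat.mul_le_mul_right B (hB T)).trans hones)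
  exact hJ.hasGrouping_of_assignment (by omega) gr (by simpa using hgr)

end Primitive

/-! ### Conclusion -/

/-- The self-similar set of a simple augmented tree whose incidence matrices are all rearrangeable,
or all primitive, is coded by the sequences of letters. -/
theorem IsSelfSimilarSet.isCoded (hr0 : 0 < r) (hr1 : r < 1) (hK : F.IsSelfSimilarSet K)
    (hm : 0 < m) (hH : F.ConditionH K) (hJ : F.IsInvariantSet J) (hS : F.IsSimple J)
    (hA : F.HasRearrangeableIncidence J ∨ F.HasPrimitiveIncidence J) : IsCoded K (Fin m) r := by
  obtain rfl | hm2 : m = 1 ∨ 2 ≤ m := by omega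
  · exact hK.isCoded_of_hasGrouping hr0 hr1 hH hJ (ncard_supp_le_one rfl)
      (fun T => ⟨1, le_rfl, le_rfl, hasGrouping_of_subsingleton rfl T⟩)
  obtain ⟨B, hB⟩ := hS.exists_ncard_le hm2
  obtain ⟨κ, hκ⟩ : ∃ κ, ∀ T : F.Component J, ∃ k, 1 ≤ k ∧ k ≤ κ ∧ HasGrouping T k := by
    rcases hA with hA | hA
    · exact ⟨1, fun T => ⟨1, le_rfl, le_rfl, hasGrouping_of_rearrangeable hm2 hJ hS hA T⟩⟩
    · exact exists_hasGrouping_of_primitive hm2 hJ hS hA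
  exact hK.isCoded_of_hasGrouping hr0 hr1 hH hJ hB hκ

/-- A self-similar set of at least two maps that is coded by the sequences of letters is Lipschitz
equivalent to a dust-like self-similar set, which depends on the number of maps and the ratio
only. -/
theorem exists_isDustLike_of_isCoded (hr0 : 0 < r) (hr1 : r < 1) (hm : 2 ≤ m)
    (hK : IsCoded K (Fin m) r) :
    ∃ (n : ℕ) (s : ℝ) (D : EqualRatioIFS d n s) (L : Set (EuclideanSpace ℝ (Fin d))),
      0 < s ∧ s < 1 ∧ D.IsDustLike L ∧
        ∀ A : Set (EuclideanSpace ℝ (Fin d)), IsCoded A (Fin m) r → LipschitzEquivalent A L := by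
  have hd : 0 < d := by
    rcases Nat.eq_zero_or_pos d with rfl | hd
    · exfalso
      obtain ⟨f, -⟩ := hK
      have h := f.symm.injective (Subsingleton.elim (f.symm fun _ => ⟨0, by omega⟩)
        (f.symm fun _ => ⟨1, by omega⟩))
      simpa using congrFun h 0
    · exact hd
  obtain ⟨k, N, hk, hN, hNr, hmN⟩ := exists_grid hd hr0 hr1
    (hK.card_mul_pow_lt_one hd (by omega) hr0 hr1)
  have : NeZero (m ^ k) := ⟨by positivity⟩
  have : NeZero k := ⟨hk.ne'⟩
  obtain ⟨D, L, hD, hL⟩ := exists_isDustLike_of_grid (d := d) (s := r ^ k) (pow_pos hr0 k)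
    (pow_lt_one₀ hr0.le hr1 hk.ne') hN hNr hmN
  refine ⟨m ^ k, r ^ k, D, L, pow_pos hr0 k, pow_lt_one₀ hr0.le hr1 hk.ne', hD, fun A hA => ?_⟩
  -- Blocks of `k` letters form an alphabet of `m ^ k` letters at ratio `r ^ k`, the same model as
  -- for `L`.
  exact ((hA.block k).relabel finFunctionFinEquiv).lipschitzEquivalent (pow_pos hr0 k) hL

end EqualRatioIFS

theorem theorem3p9 (d m : ℕ) (r : ℝ) (hr0 : 0 < r) (hr1 : r < 1)
    (F F' : EqualRatioIFS d m r)
    (K K' : Set (EuclideanSpace ℝ (Fin d)))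
    (hK : F.IsSelfSimilarSet K) (hK' : F'.IsSelfSimilarSet K')
    (hH : F.ConditionH K) (hH' : F'.ConditionH K')
    (J J' : Set (EuclideanSpace ℝ (Fin d)))
    (hJ : F.IsInvariantSet J) (hJ' : F'.IsInvariantSet J')
    (hS : F.IsSimple J) (hS' : F'.IsSimple J')
    (hA : F.HasRearrangeableIncidence J ∨ F.HasPrimitiveIncidence J)
    (hA' : F'.HasRearrangeableIncidence J' ∨ F'.HasPrimitiveIncidence J') :
    LipschitzEquivalent K K' ∧
      ∃ (n : ℕ) (s : ℝ) (D : EqualRatioIFS d n s) (L : Set (EuclideanSpace ℝ (Fin d))),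
        0 < s ∧ s < 1 ∧ D.IsDustLike L ∧
          LipschitzEquivalent K L ∧ LipschitzEquivalent K' L := by
  have hm : 0 < m := by
    obtain ⟨x, hx⟩ := hK.nonempty
    rw [hK.eq_iUnion] at hx
    exact Fin.pos (Set.mem_iUnion.1 hx).choose
  have hc := hK.isCoded hr0 hr1 hm hH hJ hS hA
  have hc' := hK'.isCoded hr0 hr1 hm hH' hJ' hS' hA'
  refine ⟨hc.lipschitzEquivalent hr0 hc', ?_⟩
  obtain rfl | hm2 : m = 1 ∨ 2 ≤ m := by omega
  -- With a single map, `K` is dust-like vacuously and serves as its own model.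
  · exact ⟨1, r, F, K, hr0, hr1, ⟨hK, fun i j hij => absurd (Subsingleton.elim i j) hij⟩,
      LipschitzEquivalent.refl K, hc'.lipschitzEquivalent hr0 hc⟩
  · obtain ⟨n, s, D, L, hs0, hs1, hD, hL⟩ :=
      EqualRatioIFS.exists_isDustLike_of_isCoded hr0 hr1 hm2 hc
    exact ⟨n, s, D, L, hs0, hs1, hD, hL K hc, hL K' hc'⟩
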